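/- Let $q$ be a complex number with $0<|q|<1$, fix $\eta\in\mathbb C$ with $e^{\eta}=q$ and put $q^{a}:=e^{a\eta}$. Let $c^{m\pm}\in\mathbb C$ ($m\in\mathbb Z/2$, so that $c^{(m+2)\pm}=c^{m\pm}$) be arbitrary. Let $\overline V$ be the completion by formal power series of $\bigotimes_{m=1,2}\mathbb C[e^{-\alpha_0},e^{-\alpha_1}]^{(m^-)}\otimes\mathbb C[e^{\alpha_0},e^{\alpha_1}]^{(m^+)}$, the state space of the four lattice points $1^-,1^+,2^-,2^+$ of the $2$-periodic chain (points $m^\pm$ and $(m+2)^\pm$ are identified). At each point $m^{\pm}$ let $E_i^\pm$ ($i=0,1$) be multiplication by $-(q-q^{-1})e^{\pm\alpha_i}$, let $\Delta^{m\pm}=E_0^\pm E_1^\pm$, let $h_1$ and $d$ be the derivations with $h_1e^{\pm\alpha_1}=\pm2e^{\pm\alpha_1}$, $h_1e^{\pm\alpha_0}=\mp2e^{\pm\alpha_0}$, $d\,e^{\pm\alpha_0}=\pm e^{\pm\alpha_0}$, $d\,e^{\pm\alpha_1}=0$, and let $k=q^{h_1}$. On $\overline V$-valued functions of $z\in\mathbb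 C^\times$ let $q^{a\,d_z}$ be the dilation $\varphi(z)\mapsto\varphi(q^{a}z)$. Write $(x,Q)_\infty=\prod_{n\ge0}(1-xQ^n)$, and let $$L_z^+(m^+)=\frac{(q^4z^{-1}\Delta^{m+},q^4)_\infty}{(q^2z^{-1}\Delta^{m+},q^4)_\infty}\begin{pmatrix}1&z^{-1}E_0^+\\E_1^+&1\end{pmatrix}\begin{pmatrix}k^{-1/2}&0\\0&k^{1/2}\end{pmatrix}q^{-c^{m+}d_z},$$ $$L_z^-(m^-)=\frac{(q^4z\Delta^{m-},q^4)_\infty}{(q^2z\Delta^{m-},q^4)_\infty}\begin{pmatrix}1&E_1^-\\zE_0^-&1\end{pmatrix}\begin{pmatrix}k^{-1/2}&0\\0&k^{1/2}\end{pmatrix}q^{-c^{m-}d_z},$$ $$R^{m^+n^-}=(qE_1^+\otimes E_1^-,q^2)_\infty^{-1}(q^2\Delta^{m+}\otimes\Delta^{n-},q^4)_\infty^{-1}(qE_0^+\otimes E_0^-,q^2)_\infty^{-1}q^{-T},\quad T=\tfrac12h_1\otimes h_1+c^{m+}\otimes d+d\otimes c^{n-}.$$ Put $\mathcal H_0=R^{1^+1^-}R^{2^+2^-}$,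 $\mathcal H_1=R^{2^+1^-}R^{1^+2^-}$ and $\mathcal T(O)=(\mathcal H_0\mathcal H_1)^{-1}O\,\mathcal H_0\mathcal H_1$ (applied to matrices entrywise), $\mathcal B(z)=\mathcal H_0L_z^-(2^-)\mathcal H_1$, $G(z)=\mathcal H_1^{-1}L_z^-(2^-)\mathcal H_1$. For a word in the lattice points let $\mathcal L_z(\cdots)$ be the product, in the order of the word, of the factors $L_z^+(m^+)$ for $m^+$ and $L_z^-(m^-)^{-1}$ for $m^-$. Put $c=c^{1-}+c^{2-}-c^{1+}-c^{2+}$, $q^D=q^{c\,d_z}$ and $L(\cdots)=q^{-D}\mathcal L_z(\cdots)$. Then all $R^{m^+n^-}$, $L_z^-(m^-)$ and $G(z)$ are invertible, and the quantized discrete Schlesinger equation $$\mathcal L_z(1^-1^+2^-2^+)\,\mathcal B(z)=\mathcal B(z)\,\mathcal L_z(1^+2^-2^+1^-)$$ holds. Equivalently, the matrices $L(1^-1^+2^-2^+)$ and $L(1^+2^-2^+1^-)$ contain no dilation of $z$ (they act at each $z$ separately), and $$L(1^-1^+2^-2^+)\,\mathcal B(z)=\mathcal B(zq^{-c})\,L(1^+2^-2^+1^-),$$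 where $L(1^+2^-2^+1^-)=G(zq^{-c})^{-1}\,\mathcal T\big(L(1^-1^+2^-2^+)\big)\,G(z)$ is the time evolution of $L(1^-1^+2^-2^+)$ up to a gauge transformation. The same holds with $z$ replaced by $sz$ for any fixed $s\in\mathbb C^\times$ in all the matrices above. -/

import Mathlib

/-!
The two-periodic quantum chain: its completed state space, the local Lax matrices, the
R matrices, the discrete time evolution and the ordered products of Lax matrices.

Throughout `η` is a complex number with negative real part and `q = exp η`, so that every `q` with
`0 < |q| < 1` and every branch of `q ^ a = exp (a η)` occur.
-/

noncomputable section

namespace QPVI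

open Filter MvPowerSeries

/-- The two kinds of lattice points `m⁺` and `m⁻`. -/
inductive Sgn : Type
  | plus
  | minus
  deriving DecidableEq

/-- `+1` for `m⁺` and `-1` for `m⁻`. -/
def Sgn.val : Sgn → ℂ
  | .plus => 1
  | .minus => -1

/-- The variables of the state space: `(m, ±, i)` stands for `e^{± α_i}` at the lattice point `m^±`,
where `m` is taken modulo `2`. -/
abbrev Idx : Type := ZMod 2 × Sgn × Fin 2

/-- The completed state space: the completion, by formal power series, of the tensor product of
the four spaces `ℂ[e^{± α_0}, e^{± α_1}]` attached to the points `1⁻, 1⁺, 2⁻, 2⁺`. -/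
abbrev State : Type := MvPowerSeries Idx ℂ

/-- State-valued functions of the spectral variable `z ∈ ℂˣ`. -/
abbrev Wave : Type := ℂˣ → State

/-- Operators on state-valued functions of `z`. -/
abbrev Op : Type := Module.End ℂ Wave

/-- `2 × 2` matrices of operators. -/
abbrev OpMat : Type := Matrix (Fin 2) (Fin 2) Op

/-! ### The infinite product `(x, Q)_∞` -/

/-- The finite product `∏_{n < N} (1 - x Q ^ n)`. -/
def qPochFin (Q : ℂ) (x : State) (N : ℕ) : State :=
  ∏ n ∈ Finset.range N, (1 - x * C (Q ^ n))

/-- The infinite product `(x, Q)_∞ = ∏_{n ≥ 0} (1 - x Q ^ n)`, as the coefficientwise limit of the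
finite products. -/
def qPoch (Q : ℂ) (x : State) : State :=
  fun m => limUnder atTop fun N => coeff m (qPochFin Q x N)

/-- The finite products do converge coefficientwise when `|Q| < 1` and `x` has no constant term. -/
theorem qPoch_tendsto (Q : ℂ) (hQ : ‖Q‖ < 1) (x : State) (hx : constantCoeff x = 0)
    (m : Idx →₀ ℕ) :
    Tendsto (fun N => coeff m (qPochFin Q x N)) atTop (nhds (coeff m (qPoch Q x))) := by
  classical
  suffices h : ∀ m : Idx →₀ ℕ, CauchySeq fun N => coeff m (qPochFin Q x N) from
    (h m).tendsto_limUnder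
  intro m
  induction m using WellFoundedLT.induction with
  | ind m ih =>
    have hb : ∀ j : Idx →₀ ℕ, ∃ K : ℝ, 0 ≤ K ∧ (j < m → ∀ N, ‖coeff j (qPochFin Q x N)‖ ≤ K) := by
      intro j
      by_cases hj : j < m
      · obtain ⟨K, hK⟩ := (Metric.isBounded_range_of_tendsto _
          (ih j hj).tendsto_limUnder).exists_norm_le
        exact ⟨|K|, abs_nonneg K, fun _ N => (hK _ ⟨N, rfl⟩).trans (le_abs_self K)⟩
      · exact ⟨0, le_rfl, fun h => absurd h hj⟩
    choose K hK0 hK using hb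
    refine cauchySeq_of_le_geometric ‖Q‖
      (∑ p ∈ Finset.HasAntidiagonal.antidiagonal m, ‖coeff p.1 x‖ * K p.2) hQ fun N => ?_
    have hstep : qPochFin Q x (N + 1) =
        qPochFin Q x N - (x * qPochFin Q x N) * C (Q ^ N) := by
      rw [qPochFin, Finset.prod_range_succ, ← qPochFin]; ring
    rw [hstep, dist_eq_norm, map_sub, sub_sub_cancel, coeff_mul_C, coeff_mul, norm_mul, norm_pow]
    refine mul_le_mul_of_nonneg_right ?_ (by positivity)
    refine (norm_sum_le _ _).trans (Finset.sum_le_sum fun p hp => ?_)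
    rw [norm_mul]
    rcases eq_or_ne p.1 0 with h0 | h0
    · have : coeff p.1 x = 0 := by rw [h0]; simpa using hx
      simp [this]
    · refine mul_le_mul_of_nonneg_left (hK _ ?_ N) (norm_nonneg _)
      rw [← Finset.HasAntidiagonal.mem_antidiagonal.1 hp]
      exact lt_add_of_pos_left _ (pos_iff_ne_zero.2 h0)

/-! ### Elementary operators -/

/-- The number `q ^ a = exp (a η)`, as a unit. -/
def qpow (η a : ℂ) : ℂˣ := Units.mk0 (Complex.exp (a * η)) (Complex.exp_ne_zero _)

/-- Multiplication by a state-valued function of `z`. -/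
def mulOp (F : Wave) : Op := LinearMap.mulLeft ℂ F

/-- The operator that multiplies the monomial with exponent `m` by `w m`. -/
def diagOp (w : (Idx →₀ ℕ) → ℂ) : Op where
  toFun φ := fun z m => w m * coeff m (φ z)
  map_add' φ ψ := by
    funext z m
    change w m * coeff m (φ z + ψ z) = w m * coeff m (φ z) + w m * coeff m (ψ z)
    rw [map_add, mul_add]
  map_smul' a φ := by
    funext z m
    change w m * coeff m (a • φ z) = a * (w m * coeff m (φ z))
    rw [coeff_smul]
    ring

/-- The dilation `φ(z) ↦ φ(a z)`; for `a = q ^ s` this is `q ^ (s d)` with `d = z d/dz`. -/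
def dil (a : ℂˣ) : Op where
  toFun φ := fun z => φ (a * z)
  map_add' _ _ := rfl
  map_smul' _ _ := rfl

/-- An operator as a scalar `2 × 2` matrix. -/
def scal (X : Op) : OpMat := Matrix.diagonal fun _ => X

/-! ### The representations attached to the lattice points -/

/-- `E_i^±  = -(q - q⁻¹) e^{± α_i}` at the point `m^±`, acting by multiplication. -/
def E (η : ℂ) (m : ZMod 2) (ε : Sgn) (i : Fin 2) : State :=
  C (-(Complex.exp η - (Complex.exp η)⁻¹)) * X (m, ε, i)

/-- `Δ^± = E_0^± E_1^±` at the point `m^±`. -/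
def Del (η : ℂ) (m : ZMod 2) (ε : Sgn) : State := E η m ε 0 * E η m ε 1

/-- The eigenvalue of `h_1` at `m^±` on a monomial: the derivation with
`e^{± α_1} ↦ ± 2 e^{± α_1}` and `e^{± α_0} ↦ ∓ 2 e^{± α_0}`. -/
def hEig (m : ZMod 2) (ε : Sgn) (a : Idx →₀ ℕ) : ℂ :=
  ε.val * (2 * (a (m, ε, 1) : ℂ) - 2 * (a (m, ε, 0) : ℂ))

/-- The eigenvalue of the scaling element `d` at `m^±` on a monomial: the derivation with
`e^{± α_0} ↦ ± e^{± α_0}` and `e^{± α_1} ↦ 0`. -/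
def dEig (m : ZMod 2) (ε : Sgn) (a : Idx →₀ ℕ) : ℂ := ε.val * (a (m, ε, 0) : ℂ)

/-- The operator `k ^ s = q ^ (s h_1)` at the point `m^±`. -/
def kpow (η : ℂ) (m : ZMod 2) (ε : Sgn) (s : ℂ) : Op :=
  diagOp fun a => Complex.exp (s * hEig m ε a * η)

/-- The matrix `diag (k ^ (-1/2), k ^ (1/2))` at the point `m^±`. -/
def kMat (η : ℂ) (m : ZMod 2) (ε : Sgn) : OpMat :=
  !![kpow η m ε (-1 / 2), 0; 0, kpow η m ε (1 / 2)]

/-! ### The local Lax matrices and the R matrices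

The parameters `c m ε` are the values of the central element at the points `m^±`. The Lax matrices
are taken with spectral parameter `s z`, where `s` is a fixed unit and `z` is the variable. -/

/-- `L_{s z}^+` at the point `m⁺`. -/
def Lplus (η : ℂ) (c : ZMod 2 → Sgn → ℂ) (s : ℂˣ) (m : ZMod 2) : OpMat :=
  scal (mulOp fun z =>
      qPoch (Complex.exp η ^ 4) (C (Complex.exp η ^ 4 * ((s * z)⁻¹ : ℂˣ)) * Del η m .plus) *
      (qPoch (Complex.exp η ^ 4) (C (Complex.exp η ^ 2 * ((s * z)⁻¹ : ℂˣ)) * Del η m .plus))⁻¹) *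
    !![1, mulOp fun z => C (((s * z)⁻¹ : ℂˣ) : ℂ) * E η m .plus 0;
       mulOp fun _ => E η m .plus 1, 1] *
    kMat η m .plus * scal (dil (qpow η (-c m .plus)))

/-- `L_{s z}^-` at the point `m⁻`. -/
def Lminus (η : ℂ) (c : ZMod 2 → Sgn → ℂ) (s : ℂˣ) (m : ZMod 2) : OpMat :=
  scal (mulOp fun z =>
      qPoch (Complex.exp η ^ 4) (C (Complex.exp η ^ 4 * (s * z : ℂˣ)) * Del η m .minus) *
      (qPoch (Complex.exp η ^ 4) (C (Complex.exp η ^ 2 * (s * z : ℂˣ)) * Del η m .minus))⁻¹) *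
    !![1, mulOp fun _ => E η m .minus 1;
       mulOp fun z => C ((s * z : ℂˣ) : ℂ) * E η m .minus 0, 1] *
    kMat η m .minus * scal (dil (qpow η (-c m .minus)))

/-- The matrix `R^{m⁺ n⁻}`, including the factor `q ^ (-T)` with
`T = (1/2) h_1 ⊗ h_1 + c^{m⁺} ⊗ d + d ⊗ c^{n⁻}`. -/
def R (η : ℂ) (c : ZMod 2 → Sgn → ℂ) (m n : ZMod 2) : Op :=
  mulOp (fun _ =>
      (qPoch (Complex.exp η ^ 2)
        (C (Complex.exp η) * (E η m .plus 1 * E η n .minus 1)))⁻¹ *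
      (qPoch (Complex.exp η ^ 4)
        (C (Complex.exp η ^ 2) * (Del η m .plus * Del η n .minus)))⁻¹ *
      (qPoch (Complex.exp η ^ 2)
        (C (Complex.exp η) * (E η m .plus 0 * E η n .minus 0)))⁻¹) *
  diagOp fun a => Complex.exp (-(1 / 2 * hEig m .plus a * hEig n .minus a
      + c m .plus * dEig n .minus a + dEig m .plus a * c n .minus) * η)

/-! ### The dynamics -/

/-- `H_0 = R^{1⁺1⁻} R^{2⁺2⁻}`. -/
def H0 (η : ℂ) (c : ZMod 2 → Sgn → ℂ) : Op := R η c 1 1 * R η c 2 2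

/-- `H_1 = R^{2⁺1⁻} R^{3⁺2⁻}`, where `3⁺ = 1⁺` by periodicity. -/
def H1 (η : ℂ) (c : ZMod 2 → Sgn → ℂ) : Op := R η c 2 1 * R η c 3 2

/-- The time evolution `T(O) = H⁻¹ O H` with `H = H_0 H_1`. -/
def evol (η : ℂ) (c : ZMod 2 → Sgn → ℂ) (O : Op) : Op :=
  Ring.inverse (H0 η c * H1 η c) * O * (H0 η c * H1 η c)

/-! ### Products of Lax matrices -/

/-- The factor of a lattice point: `L^+` at `m⁺` and `(L^-)⁻¹` at `m⁻`. -/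
def localLax (η : ℂ) (c : ZMod 2 → Sgn → ℂ) (s : ℂˣ) : ZMod 2 × Sgn → OpMat
  | (m, .plus) => Lplus η c s m
  | (m, .minus) => Ring.inverse (Lminus η c s m)

/-- The product of the factors of a list of lattice points, in the order of the list. -/
def lax (η : ℂ) (c : ZMod 2 → Sgn → ℂ) (s : ℂˣ) (w : List (ZMod 2 × Sgn)) : OpMat :=
  (w.map (localLax η c s)).prod

/-- The word `1⁻ 1⁺ 2⁻ 2⁺`. -/
def word : List (ZMod 2 × Sgn) := [(1, .minus), (1, .plus), (2, .minus), (2, .plus)]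

/-- The word `1⁺ 2⁻ 2⁺ 1⁻`. -/
def word' : List (ZMod 2 × Sgn) := [(1, .plus), (2, .minus), (2, .plus), (1, .minus)]

/-- The number `c = c^{1⁻} + c^{2⁻} - c^{1⁺} - c^{2⁺}`. -/
def cTot (c : ZMod 2 → Sgn → ℂ) : ℂ := c 1 .minus + c 2 .minus - c 1 .plus - c 2 .plus

/-- The product of Lax matrices with its difference operator part `q ^ D`, `D = c d`, removed:
`q ^ (-D)` times the product. -/
def laxRed (η : ℂ) (c : ZMod 2 → Sgn → ℂ) (s : ℂˣ) (w : List (ZMod 2 × Sgn)) : OpMat :=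
  scal (dil (qpow η (-cTot c))) * lax η c s w

/-- `B(s z) = H_0 L_{s z}^-(2⁻) H_1`. -/
def B (η : ℂ) (c : ZMod 2 → Sgn → ℂ) (s : ℂˣ) : OpMat :=
  scal (H0 η c) * Lminus η c s 2 * scal (H1 η c)

/-- The gauge matrix `G(s z) = H_1⁻¹ L_{s z}^-(2⁻) H_1`. -/
def gauge (η : ℂ) (c : ZMod 2 → Sgn → ℂ) (s : ℂˣ) : OpMat :=
  scal (Ring.inverse (H1 η c)) * Lminus η c s 2 * scal (H1 η c)

/-- The operator contains no dilation of `z`: it acts separately on the value at every `z`. -/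
def IsPointwise (O : Op) : Prop :=
  ∃ F : ℂˣ → Module.End ℂ State, ∀ (φ : Wave) (z : ℂˣ), O φ z = F z (φ z)

end QPVI

end

noncomputable section

namespace QPVI

open Filter MvPowerSeries

/-! ### The infinite product -/

/-! The equation is a formal consequence of two facts about single lattice points. One is the
exchange relation `L⁺ R L⁻ = L⁻ R L⁺` at every pair `m⁺`, `n⁻` (`Lplus_R_Lminus`). The other is that
a Lax matrix commutes with an R matrix not involving its point (`commute_Lplus_R`,
`commute_Lminus_R`). With these, `schlesinger_of_exchange` carries the four R matrices through the
product of Lax matrices, and no property of q-products is needed any more.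

For the exchange relation, each entry of `L^±`, and `R` itself, is written as multiplication by a
function of `z` times a weighted dilation `twist`. All twists are moved to the right (`exchange`).
The scalar factors of the Lax matrices pass through because the dilation of `z` in one Lax matrix
cancels the `c ⊗ d` part of `q^(-T)`. The `h_1 ⊗ h_1` part turns `k^(∓1/2)` into `k^(±1/2)` as an
off-diagonal entry crosses it. Conjugation by `k^(∓1/2)` rescales the outer arguments of `R` by
`q^(±1)`, and the functional equation of `(x, q²)_∞` converts this into factors `1 - E_i⁺ ⊗ E_i⁻`.
What is left is a polynomial identity between 2 × 2 matrices with commuting entries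
(`sum_matPlus_matMinus`).

Locality in `z` is bookkeeping: shifts multiply under products and invert under inverses
(`ShiftUnit`), and the exponents in either word add up to `c`. The evolved form follows from `H_0
H_1 G = B`. -/

theorem tendsto_coeff_mul_left {F : ℕ → State} {G : State}
    (h : ∀ m, Tendsto (fun N => coeff m (F N)) atTop (nhds (coeff m G))) (y : State)
    (m : Idx →₀ ℕ) : Tendsto (fun N => coeff m (F N * y)) atTop (nhds (coeff m (G * y))) := by
  classical
  simp only [coeff_mul]
  exact tendsto_finsetSum _ fun p _ => (h p.1).mul_const _

theorem constantCoeff_qPoch {Q : ℂ} (hQ : ‖Q‖ < 1) {x : State} (hx : constantCoeff x = 0) :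
    constantCoeff (qPoch Q x) = 1 := by
  have h := qPoch_tendsto Q hQ x hx 0
  simp only [coeff_zero_eq_constantCoeff_apply, qPochFin, map_prod, map_sub, map_one, map_mul, hx,
    zero_mul, sub_zero, Finset.prod_const_one] at h
  exact tendsto_nhds_unique h tendsto_const_nhds

/-- The functional equation `(x, Q)_∞ = (1 - x) (x Q, Q)_∞`. -/
theorem qPoch_eq_mul {Q : ℂ} (hQ : ‖Q‖ < 1) {x : State} (hx : constantCoeff x = 0) :
    qPoch Q x = (1 - x) * qPoch Q (C Q * x) := by
  have hx' : constantCoeff (C Q * x) = 0 := by simp [hx]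
  refine MvPowerSeries.ext fun m => ?_
  -- The product is taken with `N + 1` factors, so that splitting off the factor `n = 0` leaves
  -- exactly `N` factors with argument `Q x`.
  have h1 := (tendsto_add_atTop_iff_nat 1).2 (qPoch_tendsto Q hQ x hx m)
  have h2 := tendsto_coeff_mul_left (qPoch_tendsto Q hQ _ hx') (1 - x) m
  refine tendsto_nhds_unique h1 ?_
  rw [mul_comm (1 - x)]
  refine h2.congr fun N => ?_
  rw [qPochFin, qPochFin, Finset.prod_range_succ']
  congr 2
  · refine Finset.prod_congr rfl fun n _ => ?_
    rw [pow_succ, map_mul]; ring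
  · simp

/-! ### Multiplication operators and weighted dilations -/

/-- Multiplication operators, as an algebra homomorphism. -/
abbrev mulHom : Wave →ₐ[ℂ] Op := Algebra.lmul ℂ Wave

theorem mulHom_apply (F φ : Wave) (z : ℂˣ) : mulHom F φ z = F z * φ z := rfl

/-- The dilation by `a` combined with the weights `w`. -/
def twist (a : ℂˣ) (w : (Idx →₀ ℕ) → ℂ) : Op := dil a * diagOp w

theorem coeff_twist (a : ℂˣ) (w : (Idx →₀ ℕ) → ℂ) (φ : Wave) (z : ℂˣ) (m : Idx →₀ ℕ) :
    coeff m (twist a w φ z) = w m * coeff m (φ (a * z)) := rfl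

theorem op_ext {S T : Op} (h : ∀ φ z m, coeff m (S φ z) = coeff m (T φ z)) : S = T :=
  LinearMap.ext fun φ => funext fun z => MvPowerSeries.ext fun m => h φ z m

theorem twist_mul_twist (a b : ℂˣ) (v w : (Idx →₀ ℕ) → ℂ) :
    twist a v * twist b w = twist (a * b) (v * w) := by
  refine op_ext fun φ z m => ?_
  rw [Module.End.mul_apply, coeff_twist, coeff_twist, coeff_twist, Pi.mul_apply, mul_assoc,
    mul_left_comm b, mul_assoc]

theorem twist_one_one : twist 1 1 = 1 := by
  refine op_ext fun φ z m => ?_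
  rw [coeff_twist]; simp

theorem commute_twist (a b : ℂˣ) (v w : (Idx →₀ ℕ) → ℂ) : Commute (twist a v) (twist b w) := by
  rw [Commute, SemiconjBy, twist_mul_twist, twist_mul_twist, mul_comm a, mul_comm v]

theorem dil_eq (a : ℂˣ) : dil a = twist a 1 := by
  refine op_ext fun φ z m => ?_
  rw [coeff_twist, Pi.one_apply, one_mul]; rfl

theorem diagOp_eq (w : (Idx →₀ ℕ) → ℂ) : diagOp w = twist 1 w := by
  refine op_ext fun φ z m => ?_
  rw [coeff_twist, one_mul]; rfl

/-- The function `u(z) E_i^±` of `z`. -/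
def gen (η : ℂ) (u : ℂˣ → ℂ) (m : ZMod 2) (ε : Sgn) (i : Fin 2) : Wave :=
  fun z => C (u z) * E η m ε i

theorem constantCoeff_gen (η : ℂ) (u : ℂˣ → ℂ) (m : ZMod 2) (ε : Sgn) (i : Fin 2) (z : ℂˣ) :
    constantCoeff (gen η u m ε i z) = 0 := by
  simp [gen, E]

/-- Multiplication by a variable raises its exponent by one, so only the weights at neighbouring
exponents are compared. The weights may change from `w` to `w'`: this is how an off-diagonal Lax
entry exchanges `k^(-1/2)` and `k^(1/2)`. -/
theorem twist_mul_gen {η : ℂ} {u u' : ℂˣ → ℂ} {m : ZMod 2} {ε : Sgn} {i : Fin 2} {a : ℂˣ}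
    {w w' : (Idx →₀ ℕ) → ℂ}
    (h : ∀ z j, w (j + Finsupp.single (m, ε, i) 1) * u (a * z) = u' z * w' j) :
    twist a w * mulHom (gen η u m ε i) = mulHom (gen η u' m ε i) * twist a w' := by
  classical
  refine op_ext fun φ z j => ?_
  rw [Module.End.mul_apply, Module.End.mul_apply, coeff_twist]
  simp only [mulHom_apply, gen, E, mul_assoc, coeff_C_mul]
  simp only [X, coeff_monomial_mul, one_mul]
  split_ifs with hj
  · obtain ⟨j, rfl⟩ := exists_add_of_le hj
    rw [add_tsub_cancel_left, coeff_twist]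
    have := h z j
    rw [add_comm] at this
    linear_combination (-(Complex.exp η - (Complex.exp η)⁻¹)) * coeff j (φ (a * z)) * this
  · simp

/-- The infinite product of a function of `z`. -/
def qPochW (Q : ℂ) (x : Wave) : Wave := fun z => qPoch Q (x z)

theorem qPochFin_wave (Q : ℂ) (x : Wave) (N : ℕ) : (fun z => qPochFin Q (x z) N) =
    ∏ n ∈ Finset.range N, (1 - (Q ^ n) • x) := by
  funext z
  rw [Finset.prod_apply, qPochFin]
  refine Finset.prod_congr rfl fun n _ => ?_
  rw [Pi.sub_apply, Pi.smul_apply, smul_eq_C_mul, mul_comm]; rfl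

theorem semiconj_qPochFin {a : ℂˣ} {w : (Idx →₀ ℕ) → ℂ} {x y : Wave}
    (h : SemiconjBy (twist a w) (mulHom x) (mulHom y)) (Q : ℂ) (N : ℕ) :
    SemiconjBy (twist a w) (mulHom fun z => qPochFin Q (x z) N)
      (mulHom fun z => qPochFin Q (y z) N) := by
  rw [qPochFin_wave, qPochFin_wave]
  induction N with
  | zero =>
    rw [Finset.range_zero, Finset.prod_empty, Finset.prod_empty, map_one]
    exact SemiconjBy.one_right _
  | succ N ih =>
    rw [Finset.prod_range_succ, Finset.prod_range_succ, map_mul, map_mul]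
    refine ih.mul_right ?_
    rw [map_sub, map_sub, map_one, map_smul, map_smul]
    refine (SemiconjBy.one_right _).sub_right ?_
    rw [SemiconjBy, mul_smul_comm, h.eq, smul_mul_assoc]

/-- A twist multiplies each coefficient by a number, so the relation for finite products passes to
the coefficientwise limit and no topology on operators is needed. -/
theorem semiconj_qPochW {a : ℂˣ} {w : (Idx →₀ ℕ) → ℂ} {x y : Wave}
    (h : SemiconjBy (twist a w) (mulHom x) (mulHom y)) {Q : ℂ} (hQ : ‖Q‖ < 1)
    (hx : ∀ z, constantCoeff (x z) = 0) (hy : ∀ z, constantCoeff (y z) = 0) :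
    SemiconjBy (twist a w) (mulHom (qPochW Q x)) (mulHom (qPochW Q y)) := by
  refine op_ext fun φ z j => ?_
  have h1 := (tendsto_coeff_mul_left (qPoch_tendsto Q hQ _ (hx (a * z))) (φ (a * z)) j).const_mul
    (w j)
  have h2 := tendsto_coeff_mul_left (qPoch_tendsto Q hQ _ (hy z)) (twist a w φ z) j
  refine tendsto_nhds_unique h1 (h2.congr fun N => ?_)
  exact (congrArg (fun T : Op => coeff j (T φ z)) (semiconj_qPochFin h Q N).eq).symm

theorem wave_mul_inv {x : Wave} (hx : ∀ z, constantCoeff (x z) ≠ 0) : x * x⁻¹ = 1 :=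
  funext fun z => MvPowerSeries.mul_inv_cancel _ (hx z)

theorem semiconj_inv {P : Op} {x y : Wave} (h : SemiconjBy P (mulHom x) (mulHom y))
    (hx : ∀ z, constantCoeff (x z) ≠ 0) (hy : ∀ z, constantCoeff (y z) ≠ 0) :
    SemiconjBy P (mulHom x⁻¹) (mulHom y⁻¹) := by
  have e1 : mulHom x * mulHom x⁻¹ = 1 := by rw [← map_mul, wave_mul_inv hx, map_one]
  have e2 : mulHom y⁻¹ * mulHom y = 1 := by rw [← map_mul, mul_comm, wave_mul_inv hy, map_one]
  calc P * mulHom x⁻¹ = mulHom y⁻¹ * mulHom y * P * mulHom x⁻¹ := by rw [e2, one_mul]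
    _ = mulHom y⁻¹ * (P * mulHom x) * mulHom x⁻¹ := by rw [h.eq]; noncomm_ring
    _ = mulHom y⁻¹ * P * (mulHom x * mulHom x⁻¹) := by noncomm_ring
    _ = mulHom y⁻¹ * P := by rw [e1, mul_one]

/-! ### Normal forms of the Lax matrices and of the R matrices -/

theorem hEig_add_zero (m : ZMod 2) (ε : Sgn) (a : Idx →₀ ℕ) :
    hEig m ε (a + Finsupp.single (m, ε, 0) 1) = hEig m ε a - 2 * ε.val := by
  simp [hEig]; ring

theorem hEig_add_one (m : ZMod 2) (ε : Sgn) (a : Idx →₀ ℕ) :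
    hEig m ε (a + Finsupp.single (m, ε, 1) 1) = hEig m ε a + 2 * ε.val := by
  simp [hEig]; ring

theorem dEig_add_zero (m : ZMod 2) (ε : Sgn) (a : Idx →₀ ℕ) :
    dEig m ε (a + Finsupp.single (m, ε, 0) 1) = dEig m ε a + ε.val := by
  simp [dEig]; ring

theorem dEig_add_one (m : ZMod 2) (ε : Sgn) (a : Idx →₀ ℕ) :
    dEig m ε (a + Finsupp.single (m, ε, 1) 1) = dEig m ε a := by
  simp [dEig]

theorem hEig_add_of_ne {m m' : ZMod 2} {ε ε' : Sgn} (h : (m', ε') ≠ (m, ε)) (i : Fin 2)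
    (a : Idx →₀ ℕ) : hEig m ε (a + Finsupp.single (m', ε', i) 1) = hEig m ε a := by
  have h' : ∀ k, (m', ε', i) ≠ (m, ε, k) := fun k e => h (by simp_all)
  simp [hEig, h']

theorem dEig_add_of_ne {m m' : ZMod 2} {ε ε' : Sgn} (h : (m', ε') ≠ (m, ε)) (i : Fin 2)
    (a : Idx →₀ ℕ) : dEig m ε (a + Finsupp.single (m', ε', i) 1) = dEig m ε a := by
  have h' : ∀ k, (m', ε', i) ≠ (m, ε, k) := fun k e => h (by simp_all)
  simp [dEig, h']

theorem hEig_plus_add_minus (m n : ZMod 2) (i : Fin 2) (a : Idx →₀ ℕ) :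
    hEig m .plus (a + Finsupp.single (n, .minus, i) 1) = hEig m .plus a :=
  hEig_add_of_ne (by simp) i a

theorem hEig_minus_add_plus (m n : ZMod 2) (i : Fin 2) (a : Idx →₀ ℕ) :
    hEig m .minus (a + Finsupp.single (n, .plus, i) 1) = hEig m .minus a :=
  hEig_add_of_ne (by simp) i a

theorem dEig_plus_add_minus (m n : ZMod 2) (i : Fin 2) (a : Idx →₀ ℕ) :
    dEig m .plus (a + Finsupp.single (n, .minus, i) 1) = dEig m .plus a :=
  dEig_add_of_ne (by simp) i a

theorem dEig_minus_add_plus (m n : ZMod 2) (i : Fin 2) (a : Idx →₀ ℕ) :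
    dEig m .minus (a + Finsupp.single (n, .plus, i) 1) = dEig m .minus a :=
  dEig_add_of_ne (by simp) i a

/-- The weights of the diagonal entries of `kMat`. -/
def kWeight (η : ℂ) (m : ZMod 2) (ε : Sgn) (j : Fin 2) (a : Idx →₀ ℕ) : ℂ :=
  Complex.exp ((![-1 / 2, 1 / 2] : Fin 2 → ℂ) j * hEig m ε a * η)

/-- The weights of `q ^ (-T)`. -/
def tWeight (η : ℂ) (c : ZMod 2 → Sgn → ℂ) (m n : ZMod 2) (a : Idx →₀ ℕ) : ℂ :=
  Complex.exp (-(1 / 2 * hEig m .plus a * hEig n .minus a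
      + c m .plus * dEig n .minus a + dEig m .plus a * c n .minus) * η)

/-- The function `u(z) Δ^±` of `z`. -/
def genDel (η : ℂ) (u : ℂˣ → ℂ) (m : ZMod 2) (ε : Sgn) : Wave :=
  gen η u m ε 0 * gen η 1 m ε 1

/-- The scalar factor `(q² y, q⁴)_∞ / (y, q⁴)_∞` of a Lax matrix, where `y = q² u(z) Δ^±`. -/
def laxFactor (η : ℂ) (u : ℂˣ → ℂ) (m : ZMod 2) (ε : Sgn) : Wave :=
  qPochW (Complex.exp η ^ 4) (genDel η (fun z => Complex.exp η ^ 4 * u z) m ε) *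
    (qPochW (Complex.exp η ^ 4) (genDel η (fun z => Complex.exp η ^ 2 * u z) m ε))⁻¹

/-- The spectral parameter `(s z)⁻¹` of `L^+`. -/
def specPlus (s : ℂˣ) (z : ℂˣ) : ℂ := ((s * z)⁻¹ : ℂˣ)

/-- The spectral parameter `s z` of `L^-`. -/
def specMinus (s : ℂˣ) (z : ℂˣ) : ℂ := (s * z : ℂˣ)

/-- The unipotent factors of `L^+`. -/
def matPlus (η : ℂ) (s : ℂˣ) (m : ZMod 2) : Matrix (Fin 2) (Fin 2) Wave :=
  !![1, gen η (specPlus s) m .plus 0; gen η 1 m .plus 1, 1]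

/-- The unipotent factors of `L^-`. -/
def matMinus (η : ℂ) (s : ℂˣ) (m : ZMod 2) : Matrix (Fin 2) (Fin 2) Wave :=
  !![1, gen η 1 m .minus 1; gen η (specMinus s) m .minus 0, 1]

/-- The function `u E_i^+ ⊗ E_i^-`. -/
def genPair (η u : ℂ) (m n : ZMod 2) (i : Fin 2) : Wave :=
  gen η (fun _ => u) m .plus i * gen η 1 n .minus i

/-- The middle factor of the R matrix. -/
def midFactor (η : ℂ) (m n : ZMod 2) : Wave :=
  (qPochW (Complex.exp η ^ 4) (genDel η (fun _ => Complex.exp η ^ 2) m .plus *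
    genDel η 1 n .minus))⁻¹

/-- The multiplication part of the R matrix, with arguments `u E_1^+ ⊗ E_1^-` and
`v E_0^+ ⊗ E_0^-` in its outer factors. -/
def rFactor (η u v : ℂ) (m n : ZMod 2) : Wave :=
  (qPochW (Complex.exp η ^ 2) (genPair η u m n 1))⁻¹ * midFactor η m n *
    (qPochW (Complex.exp η ^ 2) (genPair η v m n 0))⁻¹

/-- The diagonal matrix of powers of `k` stands on the right, so the twist of an entry depends on
its column only. -/
theorem lax_normal {f : Wave} {M : Matrix (Fin 2) (Fin 2) Wave} (η : ℂ) (m : ZMod 2) (ε : Sgn)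
    (a : ℂˣ) :
    scal (mulHom f) * M.map mulHom * kMat η m ε * scal (dil a) =
      Matrix.of fun i j => mulHom (f * M i j) * twist a (kWeight η m ε j) := by
  have hk : kMat η m ε = Matrix.diagonal fun j => twist 1 (kWeight η m ε j) := by
    ext1 i j
    fin_cases i <;> fin_cases j <;> first | exact diagOp_eq _ | rfl
  rw [hk, scal, scal]
  ext1 i j
  rw [Matrix.mul_diagonal, Matrix.mul_diagonal, Matrix.diagonal_mul, Matrix.map_apply, dil_eq,
    mul_assoc, twist_mul_twist, one_mul, mul_one, Matrix.of_apply, map_mul]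

theorem Lplus_eq_prod (η : ℂ) (c : ZMod 2 → Sgn → ℂ) (s : ℂˣ) (m : ZMod 2) :
    Lplus η c s m = scal (mulHom (laxFactor η (specPlus s) m .plus)) *
      (matPlus η s m).map mulHom * kMat η m .plus * scal (dil (qpow η (-c m .plus))) := by
  have hf : laxFactor η (specPlus s) m .plus = fun z =>
      qPoch (Complex.exp η ^ 4) (C (Complex.exp η ^ 4 * ((s * z)⁻¹ : ℂˣ)) * Del η m .plus) *
      (qPoch (Complex.exp η ^ 4) (C (Complex.exp η ^ 2 * ((s * z)⁻¹ : ℂˣ)) * Del η m .plus))⁻¹ := by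
    funext z
    simp [laxFactor, qPochW, genDel, gen, specPlus, Del, mul_assoc]
  have hM : (matPlus η s m).map mulHom =
      !![1, mulOp fun z => C (((s * z)⁻¹ : ℂˣ) : ℂ) * E η m .plus 0;
      mulOp fun _ => E η m .plus 1, 1] := by
    have h1 : gen η 1 m .plus 1 = fun _ => E η m .plus 1 := by funext z; simp [gen]
    rw [matPlus, h1]
    ext1 i j
    fin_cases i <;> fin_cases j <;> first | exact map_one mulHom | rfl
  rw [hf, hM]
  rfl

theorem Lminus_eq_prod (η : ℂ) (c : ZMod 2 → Sgn → ℂ) (s : ℂˣ) (m : ZMod 2) :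
    Lminus η c s m = scal (mulHom (laxFactor η (specMinus s) m .minus)) *
      (matMinus η s m).map mulHom * kMat η m .minus * scal (dil (qpow η (-c m .minus))) := by
  have hf : laxFactor η (specMinus s) m .minus = fun z =>
      qPoch (Complex.exp η ^ 4) (C (Complex.exp η ^ 4 * (s * z : ℂˣ)) * Del η m .minus) *
      (qPoch (Complex.exp η ^ 4) (C (Complex.exp η ^ 2 * (s * z : ℂˣ)) * Del η m .minus))⁻¹ := by
    funext z
    simp [laxFactor, qPochW, genDel, gen, specMinus, Del, mul_assoc]
  have hM : (matMinus η s m).map mulHom = !![1, mulOp fun _ => E η m .minus 1;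
      mulOp fun z => C ((s * z : ℂˣ) : ℂ) * E η m .minus 0, 1] := by
    have h1 : gen η 1 m .minus 1 = fun _ => E η m .minus 1 := by funext z; simp [gen]
    rw [matMinus, h1]
    ext1 i j
    fin_cases i <;> fin_cases j <;> first | exact map_one mulHom | rfl
  rw [hf, hM]
  rfl

theorem Lplus_eq (η : ℂ) (c : ZMod 2 → Sgn → ℂ) (s : ℂˣ) (m : ZMod 2) :
    Lplus η c s m = Matrix.of fun i j =>
      mulHom (laxFactor η (specPlus s) m .plus * matPlus η s m i j) *
        twist (qpow η (-c m .plus)) (kWeight η m .plus j) := by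
  rw [Lplus_eq_prod, lax_normal]

theorem Lminus_eq (η : ℂ) (c : ZMod 2 → Sgn → ℂ) (s : ℂˣ) (m : ZMod 2) :
    Lminus η c s m = Matrix.of fun i j =>
      mulHom (laxFactor η (specMinus s) m .minus * matMinus η s m i j) *
        twist (qpow η (-c m .minus)) (kWeight η m .minus j) := by
  rw [Lminus_eq_prod, lax_normal]

theorem R_eq (η : ℂ) (c : ZMod 2 → Sgn → ℂ) (m n : ZMod 2) :
    R η c m n = mulHom (rFactor η (Complex.exp η) (Complex.exp η) m n) *
      twist 1 (tWeight η c m n) := by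
  have hf : rFactor η (Complex.exp η) (Complex.exp η) m n = fun _ =>
      (qPoch (Complex.exp η ^ 2)
        (C (Complex.exp η) * (E η m .plus 1 * E η n .minus 1)))⁻¹ *
      (qPoch (Complex.exp η ^ 4)
        (C (Complex.exp η ^ 2) * (Del η m .plus * Del η n .minus)))⁻¹ *
      (qPoch (Complex.exp η ^ 2)
        (C (Complex.exp η) * (E η m .plus 0 * E η n .minus 0)))⁻¹ := by
    funext z
    simp [rFactor, midFactor, genPair, qPochW, genDel, gen, Del, mul_assoc]
  rw [hf, ← diagOp_eq]
  rfl

/-! ### The exchange relation -/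

/-- In `∑ l` the weight `U l` turns `θ` into `θ₁ l`, the scalar `g` passes `U l * t`, and `N l j`
replaces `U l` by `U j`. The operator part thus no longer depends on `l`, and the claim reduces to
the identity `h` in the commutative ring `W`. -/
theorem exchange {W A : Type*} [CommRing W] [Ring A] (μ : W →+* A)
    (M N : Matrix (Fin 2) (Fin 2) W) (f g θ : W) (θ₁ θ₂ : Fin 2 → W) (U V : Fin 2 → A) (t : A)
    (hθ₁ : ∀ l, SemiconjBy (U l) (μ θ) (μ (θ₁ l))) (hθ₂ : ∀ l, SemiconjBy (V l) (μ θ) (μ (θ₂ l)))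
    (hg : ∀ l, Commute (U l * t) (μ g)) (hf : ∀ l, Commute (V l * t) (μ f))
    (hN : ∀ l j, U l * t * μ (N l j) = μ (N l j) * (U j * t))
    (hM : ∀ l j, V l * t * μ (M l j) = μ (M l j) * (V j * t))
    (h : ∀ i j, ∑ l, M i l * θ₁ l * N l j = ∑ l, N i l * θ₂ l * M l j)
    (hUV : ∀ j, U j * t * V j = V j * t * U j) :
    (Matrix.of fun i j => μ (f * M i j) * U j) * Matrix.diagonal (fun _ => μ θ * t) *
      (Matrix.of fun i j => μ (g * N i j) * V j) =
    (Matrix.of fun i j => μ (g * N i j) * V j) * Matrix.diagonal (fun _ => μ θ * t) *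
      (Matrix.of fun i j => μ (f * M i j) * U j) := by
  -- Stated for arbitrary data because it is used twice, the second time with the two Lax matrices
  -- interchanged.
  have key : ∀ (M N : Matrix (Fin 2) (Fin 2) W) (f g : W) (θ₁ : Fin 2 → W) (U V : Fin 2 → A)
      (_ : ∀ l, SemiconjBy (U l) (μ θ) (μ (θ₁ l))) (_ : ∀ l, Commute (U l * t) (μ g))
      (_ : ∀ l j, U l * t * μ (N l j) = μ (N l j) * (U j * t)) (i j : Fin 2),
      ((Matrix.of fun i j => μ (f * M i j) * U j) * Matrix.diagonal (fun _ => μ θ * t) *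
        (Matrix.of fun i j => μ (g * N i j) * V j) : Matrix (Fin 2) (Fin 2) A) i j =
      μ (f * g * ∑ l, M i l * θ₁ l * N l j) * (U j * t * V j) := by
    intro M N f g θ₁ U V hθ hg hN i j
    rw [Matrix.mul_apply, Finset.mul_sum, map_sum, Finset.sum_mul]
    refine Finset.sum_congr rfl fun l _ => ?_
    rw [Matrix.mul_diagonal, Matrix.of_apply, Matrix.of_apply]
    calc μ (f * M i l) * U l * (μ θ * t) * (μ (g * N l j) * V j)
        = μ (f * M i l) * (U l * μ θ) * t * μ g * μ (N l j) * V j := by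
          rw [map_mul μ g]; noncomm_ring
      _ = μ (f * M i l) * μ (θ₁ l) * (U l * t * μ g) * μ (N l j) * V j := by
          rw [(hθ l).eq]; noncomm_ring
      _ = μ (f * M i l) * μ (θ₁ l) * μ g * (U l * t * μ (N l j)) * V j := by
          rw [(hg l).eq]; noncomm_ring
      _ = μ (f * M i l) * μ (θ₁ l) * μ g * μ (N l j) * (U j * t * V j) := by
          rw [hN]; noncomm_ring
      _ = μ (f * g * (M i l * θ₁ l * N l j)) * (U j * t * V j) := by
          rw [← map_mul, ← map_mul, ← map_mul]; congr 2; ring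
  ext1 i j
  rw [key M N f g θ₁ U V hθ₁ hg hN, key N M g f θ₂ V U hθ₂ hf hM, h, hUV, mul_comm f]

theorem norm_exp_pow_lt_one {η : ℂ} (hη : η.re < 0) {k : ℕ} (hk : k ≠ 0) :
    ‖Complex.exp η ^ k‖ < 1 := by
  rw [norm_pow, Complex.norm_exp]
  exact pow_lt_one₀ (Real.exp_nonneg _) (by rwa [Real.exp_lt_one_iff]) hk

theorem constantCoeff_genDel (η : ℂ) (u : ℂˣ → ℂ) (m : ZMod 2) (ε : Sgn) (z : ℂˣ) :
    constantCoeff (genDel η u m ε z) = 0 := by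
  simp [genDel, constantCoeff_gen]

theorem constantCoeff_genPair (η u : ℂ) (m n : ZMod 2) (i : Fin 2) (z : ℂˣ) :
    constantCoeff (genPair η u m n i z) = 0 := by
  simp [genPair, constantCoeff_gen]

theorem constantCoeff_qPochW_ne_zero {Q : ℂ} (hQ : ‖Q‖ < 1) {x : Wave}
    (hx : ∀ z, constantCoeff (x z) = 0) (z : ℂˣ) : constantCoeff (qPochW Q x z) ≠ 0 := by
  rw [qPochW, constantCoeff_qPoch hQ (hx z)]
  exact one_ne_zero

theorem constantCoeff_inv_wave_ne_zero {x : Wave} (hx : ∀ z, constantCoeff (x z) ≠ 0) (z : ℂˣ) :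
    constantCoeff (x⁻¹ z) ≠ 0 := by
  rw [Pi.inv_apply, constantCoeff_inv]
  exact inv_ne_zero (hx z)

/-- Twists that commute with `u(z) Δ^±` commute with the scalar factor of the Lax matrix. -/
theorem commute_laxFactor {η : ℂ} (hη : η.re < 0) {u : ℂˣ → ℂ} {m : ZMod 2} {ε : Sgn} {a : ℂˣ}
    {w : (Idx →₀ ℕ) → ℂ}
    (h : ∀ r : ℂ, Commute (twist a w) (mulHom (genDel η (fun z => r * u z) m ε))) :
    Commute (twist a w) (mulHom (laxFactor η u m ε)) := by
  have hQ := norm_exp_pow_lt_one hη (k := 4) (by norm_num)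
  rw [laxFactor, map_mul]
  refine SemiconjBy.mul_right (semiconj_qPochW (h _) hQ ?_ ?_)
    (semiconj_inv (semiconj_qPochW (h _) hQ ?_ ?_) ?_ ?_)
  any_goals exact constantCoeff_genDel _ _ _ _
  all_goals exact constantCoeff_qPochW_ne_zero hQ (constantCoeff_genDel _ _ _ _)

theorem semiconj_rFactor {η : ℂ} (hη : η.re < 0) {m n : ZMod 2} {a : ℂˣ}
    {w : (Idx →₀ ℕ) → ℂ} {u u' v v' : ℂ}
    (h₁ : SemiconjBy (twist a w) (mulHom (genPair η u m n 1)) (mulHom (genPair η u' m n 1)))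
    (h₀ : SemiconjBy (twist a w) (mulHom (genPair η v m n 0)) (mulHom (genPair η v' m n 0)))
    (h : Commute (twist a w) (mulHom (genDel η (fun _ => Complex.exp η ^ 2) m .plus *
      genDel η 1 n .minus))) :
    SemiconjBy (twist a w) (mulHom (rFactor η u v m n)) (mulHom (rFactor η u' v' m n)) := by
  have hQ := norm_exp_pow_lt_one hη (k := 4) (by norm_num)
  have hQ' := norm_exp_pow_lt_one hη (k := 2) (by norm_num)
  have hc : ∀ z, constantCoeff ((genDel η (fun _ => Complex.exp η ^ 2) m .plus *
      genDel η 1 n .minus) z) = 0 := fun z => by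
    rw [Pi.mul_apply, map_mul, constantCoeff_genDel, zero_mul]
  have hp := fun u i => constantCoeff_genPair η u m n i
  have hp' := fun u i => constantCoeff_qPochW_ne_zero hQ' (hp u i)
  have hc' := constantCoeff_qPochW_ne_zero hQ hc
  have s₁ := semiconj_inv (semiconj_qPochW h₁ hQ' (hp u 1) (hp u' 1)) (hp' u 1) (hp' u' 1)
  have s₀ := semiconj_inv (semiconj_qPochW h₀ hQ' (hp v 0) (hp v' 0)) (hp' v 0) (hp' v' 0)
  have sm := semiconj_inv (semiconj_qPochW h hQ hc hc) hc' hc'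
  rw [rFactor, rFactor, midFactor, map_mul, map_mul, map_mul, map_mul]
  exact (s₁.mul_right sm).mul_right s₀

/-- The functional equation of the outer factors of the R matrix. -/
theorem inv_qPochW_genPair {η : ℂ} (hη : η.re < 0) (m n : ZMod 2) (i : Fin 2) :
    (qPochW (Complex.exp η ^ 2) (genPair η (Complex.exp η ^ 2) m n i))⁻¹ =
      (1 - genPair η 1 m n i) * (qPochW (Complex.exp η ^ 2) (genPair η 1 m n i))⁻¹ := by
  have hQ := norm_exp_pow_lt_one hη (k := 2) (by norm_num)
  have h1 := wave_mul_inv (constantCoeff_qPochW_ne_zero hQ (constantCoeff_genPair η 1 m n i))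
  have h2 := wave_mul_inv (constantCoeff_qPochW_ne_zero hQ
    (constantCoeff_genPair η (Complex.exp η ^ 2) m n i))
  have h3 : qPochW (Complex.exp η ^ 2) (genPair η 1 m n i) = (1 - genPair η 1 m n i) *
      qPochW (Complex.exp η ^ 2) (genPair η (Complex.exp η ^ 2) m n i) := by
    funext z
    have := qPoch_eq_mul hQ (constantCoeff_genPair η 1 m n i z)
    rw [qPochW, this]
    congr 2
    simp [genPair, gen, mul_assoc]
  set A := qPochW (Complex.exp η ^ 2) (genPair η 1 m n i)
  set B := qPochW (Complex.exp η ^ 2) (genPair η (Complex.exp η ^ 2) m n i)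
  calc B⁻¹ = B⁻¹ * (A * A⁻¹) := by rw [h1, mul_one]
    _ = (1 - genPair η 1 m n i) * A⁻¹ * (B * B⁻¹) := by rw [h3]; ring
    _ = _ := by rw [h2, mul_one]

/-- The two generators of `Δ` are passed one at a time, with shifted weights in between. The number
`r` is what the weights contribute; it can be chosen to compensate the dilation of the spectral
parameter. -/
theorem semiconj_genDel {η : ℂ} {u u' : ℂˣ → ℂ} {m : ZMod 2} {ε : Sgn} {a : ℂˣ}
    {w : (Idx →₀ ℕ) → ℂ} (r : ℂ)
    (hw : ∀ j, w (j + Finsupp.single (m, ε, 1) 1 + Finsupp.single (m, ε, 0) 1) = r * w j)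
    (hu : ∀ z, r * u (a * z) = u' z) :
    SemiconjBy (twist a w) (mulHom (genDel η u m ε)) (mulHom (genDel η u' m ε)) := by
  have h0 : twist a w * mulHom (gen η u m ε 0) = mulHom (gen η (fun z => u (a * z)) m ε 0) *
      twist a (fun j => w (j + Finsupp.single (m, ε, 0) 1)) :=
    twist_mul_gen fun z j => mul_comm _ _
  have h1 : twist a (fun j => w (j + Finsupp.single (m, ε, 0) 1)) * mulHom (gen η 1 m ε 1) =
      mulHom (gen η (fun _ => r) m ε 1) * twist a w :=
    twist_mul_gen fun z j => by rw [hw, Pi.one_apply, mul_one]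
  have h2 : genDel η u' m ε = gen η (fun z => u (a * z)) m ε 0 * gen η (fun _ => r) m ε 1 := by
    funext z
    simp only [genDel, gen, Pi.mul_apply, Pi.one_apply, ← hu, map_mul, map_one]
    ring
  rw [SemiconjBy, h2, genDel, map_mul, map_mul, ← mul_assoc, h0, mul_assoc, h1, mul_assoc]

/-- The two generators in `Δ` have opposite `h_1`-weights, so `Δ` has weight zero. -/
theorem kWeight_add_Del (η : ℂ) (m n : ZMod 2) (ε ε' : Sgn) (l : Fin 2) (j : Idx →₀ ℕ) :
    kWeight η m ε l (j + Finsupp.single (n, ε', 1) 1 + Finsupp.single (n, ε', 0) 1) =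
      kWeight η m ε l j := by
  by_cases h : (n, ε') = (m, ε)
  · obtain ⟨rfl, rfl⟩ := Prod.mk.inj h
    rw [kWeight, kWeight, hEig_add_zero, hEig_add_one, add_sub_cancel_right]
  · rw [kWeight, kWeight, hEig_add_of_ne h, hEig_add_of_ne h]

theorem commute_kWeight_genDel (η : ℂ) (a : ℂˣ) {u : ℂˣ → ℂ} (hu : ∀ z, u (a * z) = u z)
    (m n : ZMod 2) (ε ε' : Sgn) (l : Fin 2) :
    Commute (twist a (kWeight η m ε l)) (mulHom (genDel η u n ε')) :=
  semiconj_genDel 1 (fun j => by rw [kWeight_add_Del, one_mul]) fun z => by rw [one_mul, hu]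

theorem commute_mulHom_one (P : Op) : Commute P (mulHom 1) := by
  rw [map_one]
  exact Commute.one_right P

theorem coe_qpow (η a : ℂ) : (qpow η a : ℂ) = Complex.exp (a * η) := rfl

theorem specPlus_qpow (η c : ℂ) (s z : ℂˣ) :
    specPlus s (qpow η (-c) * z) = Complex.exp (c * η) * specPlus s z := by
  simp only [specPlus, mul_inv, Units.val_mul, Units.val_inv_eq_inv_val, coe_qpow, neg_mul,
    Complex.exp_neg, inv_inv]
  ring

theorem specMinus_qpow (η c : ℂ) (s z : ℂˣ) :
    specMinus s (qpow η (-c) * z) = Complex.exp (-c * η) * specMinus s z := by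
  simp only [specMinus, Units.val_mul, coe_qpow]
  ring

theorem exp_sq (η : ℂ) : Complex.exp η ^ 2 = Complex.exp (2 * η) := by
  rw [← Complex.exp_nat_mul]; norm_num

/-- The multiplication part of the R matrix after conjugation by `k ^ (∓ 1/2)` at `m⁺`. -/
def rFactorConj (η : ℂ) (m n : ZMod 2) : Fin 2 → Wave :=
  ![rFactor η 1 (Complex.exp η ^ 2) m n, rFactor η (Complex.exp η ^ 2) 1 m n]

theorem semiconj_genPair_plus (η : ℂ) (a : ℂˣ) (m n : ZMod 2) {u u' : ℂ} {l i : Fin 2}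
    (h : ∀ j, kWeight η m .plus l (j + Finsupp.single (m, .plus, i) 1) * u =
      u' * kWeight η m .plus l j) :
    SemiconjBy (twist a (kWeight η m .plus l)) (mulHom (genPair η u m n i))
      (mulHom (genPair η u' m n i)) := by
  have h1 : SemiconjBy (twist a (kWeight η m .plus l)) (mulHom (gen η (fun _ => u) m .plus i))
      (mulHom (gen η (fun _ => u') m .plus i)) := twist_mul_gen fun z j => h j
  have h2 : SemiconjBy (twist a (kWeight η m .plus l)) (mulHom (gen η 1 n .minus i))
      (mulHom (gen η 1 n .minus i)) := twist_mul_gen fun z j => by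
    simp only [kWeight, hEig_plus_add_minus, Pi.one_apply, mul_one, one_mul]
  rw [genPair, genPair, map_mul, map_mul]
  exact h1.mul_right h2

theorem semiconj_genPair_minus (η : ℂ) (a : ℂˣ) (m n : ZMod 2) {u u' : ℂ} {l i : Fin 2}
    (h : ∀ j, kWeight η n .minus l (j + Finsupp.single (n, .minus, i) 1) * u =
      u' * kWeight η n .minus l j) :
    SemiconjBy (twist a (kWeight η n .minus l)) (mulHom (genPair η u m n i))
      (mulHom (genPair η u' m n i)) := by
  -- The scalar is moved to the generator at `n⁻`, the one that the weights of `k` at `n⁻` rescale.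
  have e : ∀ v : ℂ, genPair η v m n i =
      gen η (fun _ => v) n .minus i * gen η 1 m .plus i := fun v => by
    funext z
    simp only [genPair, gen, Pi.mul_apply, Pi.one_apply, map_one]
    ring
  have h1 : SemiconjBy (twist a (kWeight η n .minus l)) (mulHom (gen η (fun _ => u) n .minus i))
      (mulHom (gen η (fun _ => u') n .minus i)) := twist_mul_gen fun z j => h j
  have h2 : SemiconjBy (twist a (kWeight η n .minus l)) (mulHom (gen η 1 m .plus i))
      (mulHom (gen η 1 m .plus i)) := twist_mul_gen fun z j => by
    simp only [kWeight, hEig_minus_add_plus, Pi.one_apply, mul_one, one_mul]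
  rw [e, e, map_mul, map_mul]
  exact h1.mul_right h2

theorem commute_kWeight_genDel_mul_genDel (η : ℂ) (a : ℂˣ) (m n k : ZMod 2) (ε : Sgn) (l : Fin 2)
    (r : ℂ) : Commute (twist a (kWeight η k ε l))
      (mulHom (genDel η (fun _ => r) m .plus * genDel η 1 n .minus)) := by
  rw [map_mul]
  exact (commute_kWeight_genDel η a (fun _ => rfl) _ _ _ _ _).mul_right
    (commute_kWeight_genDel η a (fun _ => rfl) _ _ _ _ _)

/-- Conjugation by `k^(-1/2)` at `m⁺` multiplies `E_1⁺` by `q⁻¹` and `E_0⁺` by `q`, so the outer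
arguments `q`, `q` become `1`, `q²`; `k^(1/2)` does the opposite. The middle factor has weight zero.
-/
theorem semiconj_rFactor_plus {η : ℂ} (hη : η.re < 0) (a : ℂˣ) (m n : ZMod 2) (l : Fin 2) :
    SemiconjBy (twist a (kWeight η m .plus l))
      (mulHom (rFactor η (Complex.exp η) (Complex.exp η) m n))
      (mulHom (rFactorConj η m n l)) := by
  fin_cases l
  all_goals
    refine semiconj_rFactor hη (semiconj_genPair_plus η a m n fun j => ?_)
      (semiconj_genPair_plus η a m n fun j => ?_)
      (commute_kWeight_genDel_mul_genDel _ _ _ _ _ _ _ _)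
  all_goals
    simp only [kWeight, hEig_add_one, hEig_add_zero, Sgn.val, exp_sq, one_mul, ← Complex.exp_add]
    congr 1
    simp
    ring

/-- At `n⁻` the generators have the opposite `h_1`-weights, whence the index `1 - l`. -/
theorem semiconj_rFactor_minus {η : ℂ} (hη : η.re < 0) (a : ℂˣ) (m n : ZMod 2) (l : Fin 2) :
    SemiconjBy (twist a (kWeight η n .minus l))
      (mulHom (rFactor η (Complex.exp η) (Complex.exp η) m n))
      (mulHom (rFactorConj η m n (1 - l))) := by
  fin_cases l
  all_goals
    refine semiconj_rFactor hη (semiconj_genPair_minus η a m n fun j => ?_)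
      (semiconj_genPair_minus η a m n fun j => ?_)
      (commute_kWeight_genDel_mul_genDel _ _ _ _ _ _ _ _)
  all_goals
    simp only [kWeight, hEig_add_one, hEig_add_zero, Sgn.val, exp_sq, one_mul, ← Complex.exp_add]
    congr 1
    simp
    ring

/-- The functional equation gives both conjugates of the R factor as `1 - E_i⁺ ⊗ E_i⁻` times the
common function `rFactor η 1 1 m n`. The spectral parameters `(s z)⁻¹` and `s z` cancel in `E_0⁺ ⊗
E_0⁻`, after which each entry is a polynomial identity. -/
theorem sum_matPlus_matMinus {η : ℂ} (hη : η.re < 0) (s : ℂˣ) (m n : ZMod 2) (i j : Fin 2) :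
    ∑ l, matPlus η s m i l * rFactorConj η m n l * matMinus η s n l j =
      ∑ l, matMinus η s n i l * rFactorConj η m n (1 - l) * matPlus η s m l j := by
  have h1 : rFactorConj η m n 0 = (1 - genPair η 1 m n 0) * rFactor η 1 1 m n := by
    change rFactor _ _ _ _ _ = _
    rw [rFactor, rFactor, inv_qPochW_genPair hη]; ring
  have h2 : rFactorConj η m n 1 = (1 - genPair η 1 m n 1) * rFactor η 1 1 m n := by
    change rFactor _ _ _ _ _ = _
    rw [rFactor, rFactor, inv_qPochW_genPair hη]; ring
  have h0 : gen η (specPlus s) m .plus 0 * gen η (specMinus s) n .minus 0 = genPair η 1 m n 0 := by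
    funext z
    have : C (specPlus s z) * C (specMinus s z) = (1 : State) := by
      rw [← map_mul, specPlus, specMinus, ← Units.val_mul, inv_mul_cancel, Units.val_one, map_one]
    simp only [genPair, gen, Pi.mul_apply, Pi.one_apply, map_one, one_mul]
    linear_combination E η m .plus 0 * E η n .minus 0 * this
  have h3 : genPair η 1 m n 1 = gen η 1 m .plus 1 * gen η 1 n .minus 1 := rfl
  rw [Fin.sum_univ_two, Fin.sum_univ_two, sub_zero, sub_self, h1, h2, h3, ← h0]
  fin_cases i <;> fin_cases j <;> simp [matPlus, matMinus] <;> ring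

/-- The exchange relation between Lax matrices and R matrices. -/
theorem Lplus_R_Lminus {η : ℂ} (hη : η.re < 0) (c : ZMod 2 → Sgn → ℂ) (s : ℂˣ) (m n : ZMod 2) :
    Lplus η c s m * scal (R η c m n) * Lminus η c s n =
      Lminus η c s n * scal (R η c m n) * Lplus η c s m := by
  rw [Lplus_eq, Lminus_eq, R_eq, scal]
  refine exchange (mulHom : Wave →+* Op) (matPlus η s m) (matMinus η s n) _ _ _
    (rFactorConj η m n) (fun l => rFactorConj η m n (1 - l)) _ _ _
    (semiconj_rFactor_plus hη _ m n) (semiconj_rFactor_minus hη _ m n) (fun l => ?_) (fun l => ?_)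
    (fun l j => ?_) (fun l j => ?_) (sum_matPlus_matMinus hη s m n) (fun j => ?_)
  · rw [twist_mul_twist, mul_one]
    -- `Δ⁻` lowers `d` at `n⁻` by one, so `q^(-T)` contributes `q^c` with `c = c^{m⁺}`; the dilation
    -- in `L⁺` multiplies `s z` by the inverse.
    refine commute_laxFactor hη fun r => semiconj_genDel (Complex.exp (c m .plus * η))
      (fun j => ?_) fun z => ?_
    · rw [Pi.mul_apply, kWeight_add_Del, Pi.mul_apply, mul_left_comm]
      congr 1
      simp only [tWeight, hEig_plus_add_minus, dEig_plus_add_minus, hEig_add_one, hEig_add_zero,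
        dEig_add_one, dEig_add_zero, Sgn.val, ← Complex.exp_add]
      congr 1
      ring
    · rw [specMinus_qpow, neg_mul, Complex.exp_neg]
      field_simp [Complex.exp_ne_zero]
  · rw [twist_mul_twist, mul_one]
    -- The mirror image: `Δ⁺` raises `d` at `m⁺` by one, and the dilation in `L⁻` acts on `(s z)⁻¹`.
    refine commute_laxFactor hη fun r => semiconj_genDel (Complex.exp (-c n .minus * η))
      (fun j => ?_) fun z => ?_
    · rw [Pi.mul_apply, kWeight_add_Del, Pi.mul_apply, mul_left_comm]
      congr 1
      simp only [tWeight, hEig_minus_add_plus, dEig_minus_add_plus, hEig_add_one, hEig_add_zero,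
        dEig_add_one, dEig_add_zero, Sgn.val, ← Complex.exp_add]
      congr 1
      ring
    · rw [specPlus_qpow, neg_mul, Complex.exp_neg]
      field_simp [Complex.exp_ne_zero]
  · rw [twist_mul_twist, twist_mul_twist, mul_one]
    fin_cases l <;> fin_cases j
    · exact commute_mulHom_one _
    -- `E_1⁻` lowers `h_1` at `n⁻` by two, so crossing `q^(-T)` produces a factor `k` at `m⁺`, which
    -- turns `k^(-1/2)` into `k^(1/2)`.
    · refine twist_mul_gen fun z j => ?_
      simp only [Pi.mul_apply, Pi.one_apply, one_mul, mul_one, kWeight, tWeight,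
        hEig_plus_add_minus, dEig_plus_add_minus, hEig_add_one,
        dEig_add_one, Sgn.val, ← Complex.exp_add]
      congr 1
      simp
      ring
    -- `E_0⁻` produces `k⁻¹` instead, and its `d`-weight cancels the dilation of `s z`.
    · refine twist_mul_gen fun z j => ?_
      rw [specMinus_qpow]
      simp only [Pi.mul_apply, kWeight, tWeight,
        hEig_plus_add_minus, dEig_plus_add_minus, hEig_add_zero,
        dEig_add_zero, Sgn.val]
      rw [mul_comm (specMinus s z), ← mul_assoc, ← Complex.exp_add, ← Complex.exp_add,
        ← Complex.exp_add]
      congr 2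
      simp
      ring
    · exact commute_mulHom_one _
  · rw [twist_mul_twist, twist_mul_twist, mul_one]
    fin_cases l <;> fin_cases j
    · exact commute_mulHom_one _
    · refine twist_mul_gen fun z j => ?_
      rw [specPlus_qpow]
      simp only [Pi.mul_apply, kWeight, tWeight,
        hEig_minus_add_plus, dEig_minus_add_plus, hEig_add_zero,
        dEig_add_zero, Sgn.val]
      rw [mul_comm (specPlus s z), ← mul_assoc, ← Complex.exp_add, ← Complex.exp_add,
        ← Complex.exp_add]
      congr 2
      simp
      ring
    · refine twist_mul_gen fun z j => ?_
      simp only [Pi.mul_apply, Pi.one_apply, one_mul, mul_one, kWeight, tWeight,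
        hEig_minus_add_plus, dEig_minus_add_plus, hEig_add_one,
        dEig_add_one, Sgn.val, ← Complex.exp_add]
      congr 1
      simp
      ring
    · exact commute_mulHom_one _
  · rw [((commute_twist _ _ _ _).mul_left (commute_twist _ _ _ _)).eq, ← mul_assoc,
      mul_assoc, mul_assoc, (commute_twist _ _ _ _).eq]

/-! ### Operators attached to disjoint lattice points -/

theorem commute_twist_rFactor {η : ℂ} (hη : η.re < 0) {m n : ZMod 2} {a : ℂˣ}
    {w : (Idx →₀ ℕ) → ℂ} (hp : ∀ i j, w (j + Finsupp.single (m, .plus, i) 1) = w j)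
    (hm : ∀ i j, w (j + Finsupp.single (n, .minus, i) 1) = w j) (u v : ℂ) :
    Commute (twist a w) (mulHom (rFactor η u v m n)) := by
  have key : ∀ (r : ℂ) (i : Fin 2),
      Commute (twist a w) (mulHom (gen η (fun _ => r) m .plus i)) ∧
      Commute (twist a w) (mulHom (gen η (fun _ => r) n .minus i)) := fun r i =>
    ⟨twist_mul_gen fun z j => by rw [hp, mul_comm], twist_mul_gen fun z j => by rw [hm, mul_comm]⟩
  refine semiconj_rFactor hη ?_ ?_ ?_
  · rw [genPair, map_mul]
    exact (key _ _).1.mul_right (key _ _).2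
  · rw [genPair, map_mul]
    exact (key _ _).1.mul_right (key _ _).2
  · rw [genDel, genDel, map_mul, map_mul, map_mul]
    exact ((key _ _).1.mul_right (key _ _).1).mul_right ((key _ _).2.mul_right (key _ _).2)

theorem commute_mulHom (F G : Wave) : Commute (mulHom F) (mulHom G) :=
  (Commute.all F G).map mulHom

theorem commute_twist_laxFactor {η : ℂ} (hη : η.re < 0) {m : ZMod 2} {ε : Sgn} {a : ℂˣ}
    {w : (Idx →₀ ℕ) → ℂ} (h : ∀ i j, w (j + Finsupp.single (m, ε, i) 1) = w j) {u : ℂˣ → ℂ}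
    (hu : ∀ z, u (a * z) = u z) : Commute (twist a w) (mulHom (laxFactor η u m ε)) :=
  commute_laxFactor hη fun r => semiconj_genDel 1 (fun j => by rw [h, h, one_mul]) fun z => by
    rw [one_mul, hu]

theorem commute_scal {X : Op} {M : OpMat} (h : ∀ i j, Commute (M i j) X) : Commute M (scal X) := by
  rw [Commute, SemiconjBy, scal]
  ext1 i j
  rw [Matrix.mul_diagonal, Matrix.diagonal_mul, h i j]

/-- `R` involves no variable of the point `m⁺`, its weights ignore the exponents there, and it does
not depend on `z`, so the dilation in `L⁺` does not affect it. -/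
theorem commute_Lplus_R {η : ℂ} (hη : η.re < 0) (c : ZMod 2 → Sgn → ℂ) (s : ℂˣ) {m m' : ZMod 2}
    (hm : m ≠ m') (n : ZMod 2) : Commute (Lplus η c s m) (scal (R η c m' n)) := by
  refine commute_scal fun i j => ?_
  have h1 : (m', Sgn.plus) ≠ (m, .plus) := fun h => hm (Prod.mk.inj h).1.symm
  have ht : ∀ i j, tWeight η c m' n (j + Finsupp.single (m, .plus, i) 1) = tWeight η c m' n j := by
    intro i j
    simp only [tWeight, hEig_add_of_ne h1.symm, dEig_add_of_ne h1.symm, hEig_minus_add_plus,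
      dEig_minus_add_plus]
  rw [Lplus_eq, R_eq, Matrix.of_apply, map_mul]
  refine Commute.mul_left (Commute.mul_left ?_ ?_) ?_
  · exact (commute_mulHom _ _).mul_right
      (commute_twist_laxFactor hη ht fun z => by rw [one_mul]).symm
  · refine (commute_mulHom _ _).mul_right (Commute.symm ?_)
    have hg : ∀ u k, Commute (twist 1 (tWeight η c m' n)) (mulHom (gen η u m .plus k)) :=
      fun u k => twist_mul_gen fun z j => by rw [ht, one_mul, mul_comm]
    fin_cases i <;> fin_cases j
    · exact commute_mulHom_one _
    · exact hg _ _
    · exact hg _ _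
    · exact commute_mulHom_one _
  · refine Commute.mul_right (commute_twist_rFactor hη (fun i j => ?_) (fun i j => ?_) _ _)
      (commute_twist _ _ _ _)
    · simp only [kWeight, hEig_add_of_ne h1]
    · simp only [kWeight, hEig_plus_add_minus]

theorem commute_Lminus_R {η : ℂ} (hη : η.re < 0) (c : ZMod 2 → Sgn → ℂ) (s : ℂˣ) {n n' : ZMod 2}
    (hn : n ≠ n') (m : ZMod 2) : Commute (Lminus η c s n) (scal (R η c m n')) := by
  refine commute_scal fun i j => ?_
  have h1 : (n', Sgn.minus) ≠ (n, .minus) := fun h => hn (Prod.mk.inj h).1.symm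
  have ht : ∀ i j, tWeight η c m n' (j + Finsupp.single (n, .minus, i) 1) = tWeight η c m n' j := by
    intro i j
    simp only [tWeight, hEig_add_of_ne h1.symm, dEig_add_of_ne h1.symm, hEig_plus_add_minus,
      dEig_plus_add_minus]
  rw [Lminus_eq, R_eq, Matrix.of_apply, map_mul]
  refine Commute.mul_left (Commute.mul_left ?_ ?_) ?_
  · exact (commute_mulHom _ _).mul_right
      (commute_twist_laxFactor hη ht fun z => by rw [one_mul]).symm
  · refine (commute_mulHom _ _).mul_right (Commute.symm ?_)
    have hg : ∀ u k, Commute (twist 1 (tWeight η c m n')) (mulHom (gen η u n .minus k)) :=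
      fun u k => twist_mul_gen fun z j => by rw [ht, one_mul, mul_comm]
    fin_cases i <;> fin_cases j
    · exact commute_mulHom_one _
    · exact hg _ _
    · exact hg _ _
    · exact commute_mulHom_one _
  · refine Commute.mul_right (commute_twist_rFactor hη (fun i j => ?_) (fun i j => ?_) _ _)
      (commute_twist _ _ _ _)
    · simp only [kWeight, hEig_minus_add_plus]
    · simp only [kWeight, hEig_add_of_ne h1]

/-! ### Invertibility and locality in `z` -/

/-- The value of `O φ` at `z` is determined by the value of `φ` at `a z`. -/
def ActsAt (a : ℂˣ) (O : Op) : Prop :=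
  ∃ F : ℂˣ → Module.End ℂ State, ∀ (φ : Wave) (z : ℂˣ), O φ z = F z (φ (a * z))

theorem ActsAt.mul {a b : ℂˣ} {S T : Op} (hS : ActsAt a S) (hT : ActsAt b T) :
    ActsAt (a * b) (S * T) := by
  obtain ⟨F, hF⟩ := hS
  obtain ⟨G, hG⟩ := hT
  refine ⟨fun z => F z * G (a * z), fun φ z => ?_⟩
  rw [Module.End.mul_apply, hF, hG, Module.End.mul_apply, mul_left_comm, ← mul_assoc]

theorem ActsAt.add {a : ℂˣ} {S T : Op} (hS : ActsAt a S) (hT : ActsAt a T) : ActsAt a (S + T) := by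
  obtain ⟨F, hF⟩ := hS
  obtain ⟨G, hG⟩ := hT
  refine ⟨fun z => F z + G z, fun φ z => ?_⟩
  rw [LinearMap.add_apply, Pi.add_apply, hF, hG, LinearMap.add_apply]

theorem actsAt_zero (a : ℂˣ) : ActsAt a 0 := ⟨0, fun _ _ => rfl⟩

theorem actsAt_mulHom (F : Wave) : ActsAt 1 (mulHom F) :=
  ⟨fun z => LinearMap.mulLeft ℂ (F z), fun φ z => by rw [one_mul]; rfl⟩

theorem actsAt_twist (a : ℂˣ) (w : (Idx →₀ ℕ) → ℂ) : ActsAt a (twist a w) :=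
  ⟨fun _ =>
    { toFun := fun f => fun m => w m * coeff m f
      map_add' := fun f g => by
        funext m
        change w m * coeff m (f + g) = w m * coeff m f + w m * coeff m g
        rw [map_add, mul_add]
      map_smul' := fun r f => by
        funext m
        change w m * coeff m (r • f) = r * (w m * coeff m f)
        rw [coeff_smul, mul_left_comm] }, fun _ _ => rfl⟩

/-- An invertible matrix of operators that act at `a z`, whose inverse acts at `a⁻¹ z`. -/
def ShiftUnit (a : ℂˣ) (M : OpMat) : Prop :=
  ∃ N : OpMat, M * N = 1 ∧ N * M = 1 ∧ (∀ i j, ActsAt a (M i j)) ∧ ∀ i j, ActsAt a⁻¹ (N i j)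

theorem actsAt_matrix_mul {a b : ℂˣ} {M N : OpMat} (hM : ∀ i j, ActsAt a (M i j))
    (hN : ∀ i j, ActsAt b (N i j)) (i j : Fin 2) : ActsAt (a * b) ((M * N) i j) := by
  rw [Matrix.mul_apply, Fin.sum_univ_two]
  exact ((hM _ _).mul (hN _ _)).add ((hM _ _).mul (hN _ _))

theorem ShiftUnit.mul {a b : ℂˣ} {M N : OpMat} (hM : ShiftUnit a M) (hN : ShiftUnit b N) :
    ShiftUnit (a * b) (M * N) := by
  obtain ⟨M', h1, h2, h3, h4⟩ := hM
  obtain ⟨N', k1, k2, k3, k4⟩ := hN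
  refine ⟨N' * M', ?_, ?_, actsAt_matrix_mul h3 k3, ?_⟩
  · rw [mul_assoc, ← mul_assoc N, k1, one_mul, h1]
  · rw [mul_assoc, ← mul_assoc M', h2, one_mul, k2]
  · rw [mul_inv_rev]
    exact actsAt_matrix_mul k4 h4

theorem ShiftUnit.isUnit {a : ℂˣ} {M : OpMat} (h : ShiftUnit a M) : IsUnit M := by
  obtain ⟨N, h1, h2, -⟩ := h
  exact ⟨⟨M, N, h1, h2⟩, rfl⟩

/-- A two-sided inverse is unique, so `Ring.inverse M` is the inverse whose locality is already
known. -/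
theorem ShiftUnit.inverse {a : ℂˣ} {M : OpMat} (h : ShiftUnit a M) :
    ShiftUnit a⁻¹ (Ring.inverse M) := by
  obtain ⟨N, h1, h2, h3, h4⟩ := h
  have hN : Ring.inverse M = N := Ring.inverse_unit (⟨M, N, h1, h2⟩ : OpMatˣ)
  rw [hN]
  exact ⟨M, h2, h1, h4, by rwa [inv_inv]⟩

theorem shiftUnit_one : ShiftUnit 1 1 := by
  have h : ∀ i j, ActsAt 1 ((1 : OpMat) i j) := fun i j => by
    rw [Matrix.one_apply]
    split_ifs
    · rw [← map_one mulHom]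
      exact actsAt_mulHom 1
    · exact actsAt_zero 1
  exact ⟨1, one_mul 1, one_mul 1, h, by rwa [inv_one]⟩

/-- The entries come from a commutative ring, so the inverse is the adjugate one, transported by
`mulHom`. -/
theorem shiftUnit_map {M : Matrix (Fin 2) (Fin 2) Wave} (h : IsUnit M.det) :
    ShiftUnit 1 (M.map mulHom) := by
  have hm : ∀ A B : Matrix (Fin 2) (Fin 2) Wave,
      A.map mulHom * B.map mulHom = (A * B).map mulHom := fun A B =>
    (map_mul (mulHom : Wave →+* Op).mapMatrix A B).symm
  have h1 : (1 : Matrix (Fin 2) (Fin 2) Wave).map mulHom = 1 :=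
    map_one (mulHom : Wave →+* Op).mapMatrix
  refine ⟨M⁻¹.map mulHom, ?_, ?_, fun i j => actsAt_mulHom _, fun i j => ?_⟩
  · rw [hm, Matrix.mul_nonsing_inv _ h, h1]
  · rw [hm, Matrix.nonsing_inv_mul _ h, h1]
  · rw [inv_one]
    exact actsAt_mulHom _

theorem shiftUnit_diagonal_twist (a : ℂˣ) (w : Fin 2 → (Idx →₀ ℕ) → ℂ) (hw : ∀ j m, w j m ≠ 0) :
    ShiftUnit a (Matrix.diagonal fun j => twist a (w j)) := by
  have hd : ∀ (b : ℂˣ) (v : Fin 2 → (Idx →₀ ℕ) → ℂ) (i j : Fin 2),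
      ActsAt b ((Matrix.diagonal fun j => twist b (v j)) i j) := fun b v i j => by
    rw [Matrix.diagonal_apply]
    split_ifs
    · exact actsAt_twist _ _
    · exact actsAt_zero _
  refine ⟨Matrix.diagonal fun j => twist a⁻¹ (w j)⁻¹, ?_, ?_, hd _ _, hd _ _⟩
  · rw [Matrix.diagonal_mul_diagonal, ← Matrix.diagonal_one]
    congr 1
    funext j
    rw [twist_mul_twist, mul_inv_cancel, ← twist_one_one]
    congr 1
    funext m
    exact mul_inv_cancel₀ (hw j m)
  · rw [Matrix.diagonal_mul_diagonal, ← Matrix.diagonal_one]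
    congr 1
    funext j
    rw [twist_mul_twist, inv_mul_cancel, ← twist_one_one]
    congr 1
    funext m
    exact inv_mul_cancel₀ (hw j m)

theorem isUnit_wave {F : Wave} (h : ∀ z, constantCoeff (F z) ≠ 0) : IsUnit F :=
  IsUnit.of_mul_eq_one _ (wave_mul_inv h)

theorem isUnit_laxFactor {η : ℂ} (hη : η.re < 0) (u : ℂˣ → ℂ) (m : ZMod 2) (ε : Sgn) :
    IsUnit (laxFactor η u m ε) := by
  have hQ := norm_exp_pow_lt_one hη (k := 4) (by norm_num)
  have h := fun u => constantCoeff_qPochW_ne_zero hQ (constantCoeff_genDel η u m ε)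
  exact (isUnit_wave (h _)).mul (isUnit_wave (constantCoeff_inv_wave_ne_zero (h _)))

/-- The determinant is `1` minus a product of generators, hence has constant coefficient `1` at
every `z`. -/
theorem isUnit_det_matPlus (η : ℂ) (s : ℂˣ) (m : ZMod 2) : IsUnit (matPlus η s m).det := by
  refine isUnit_wave fun z => ?_
  simp [Matrix.det_fin_two, matPlus, constantCoeff_gen]

theorem isUnit_det_matMinus (η : ℂ) (s : ℂˣ) (m : ZMod 2) : IsUnit (matMinus η s m).det := by
  refine isUnit_wave fun z => ?_
  simp [Matrix.det_fin_two, matMinus, constantCoeff_gen]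

theorem shiftUnit_normal {f : Wave} (hf : IsUnit f) {M : Matrix (Fin 2) (Fin 2) Wave}
    (hM : IsUnit M.det) (η : ℂ) (m : ZMod 2) (ε : Sgn) (a : ℂˣ) :
    ShiftUnit a (Matrix.of fun i j => mulHom (f * M i j) * twist a (kWeight η m ε j)) := by
  have h : (Matrix.of fun i j => mulHom (f * M i j) * twist a (kWeight η m ε j)) =
      (f • M).map mulHom * Matrix.diagonal fun j => twist a (kWeight η m ε j) := by
    ext1 i j
    rw [Matrix.mul_diagonal]; rfl
  have hd : IsUnit (f • M).det := by
    rw [Matrix.det_smul]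
    exact (hf.pow _).mul hM
  have hk := shiftUnit_diagonal_twist a (kWeight η m ε) fun j m => Complex.exp_ne_zero _
  have hmul := (shiftUnit_map hd).mul hk
  rwa [one_mul, ← h] at hmul

theorem shiftUnit_Lplus {η : ℂ} (hη : η.re < 0) (c : ZMod 2 → Sgn → ℂ) (s : ℂˣ) (m : ZMod 2) :
    ShiftUnit (qpow η (-c m .plus)) (Lplus η c s m) := by
  rw [Lplus_eq]
  exact shiftUnit_normal (isUnit_laxFactor hη _ _ _) (isUnit_det_matPlus η s m) _ _ _ _

theorem shiftUnit_Lminus {η : ℂ} (hη : η.re < 0) (c : ZMod 2 → Sgn → ℂ) (s : ℂˣ) (m : ZMod 2) :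
    ShiftUnit (qpow η (-c m .minus)) (Lminus η c s m) := by
  rw [Lminus_eq]
  exact shiftUnit_normal (isUnit_laxFactor hη _ _ _) (isUnit_det_matMinus η s m) _ _ _ _

theorem isUnit_R {η : ℂ} (hη : η.re < 0) (c : ZMod 2 → Sgn → ℂ) (m n : ZMod 2) :
    IsUnit (R η c m n) := by
  have hQ := norm_exp_pow_lt_one hη (k := 4) (by norm_num)
  have hQ' := norm_exp_pow_lt_one hη (k := 2) (by norm_num)
  have hc : ∀ z, constantCoeff ((genDel η (fun _ => Complex.exp η ^ 2) m .plus *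
      genDel η 1 n .minus) z) = 0 := fun z => by
    rw [Pi.mul_apply, map_mul, constantCoeff_genDel, zero_mul]
  have hp := fun u i => isUnit_wave (constantCoeff_inv_wave_ne_zero
    (constantCoeff_qPochW_ne_zero hQ' (constantCoeff_genPair η u m n i)))
  rw [R_eq]
  refine IsUnit.mul (IsUnit.map mulHom ?_) ?_
  · exact ((hp _ _).mul (isUnit_wave (constantCoeff_inv_wave_ne_zero
      (constantCoeff_qPochW_ne_zero hQ hc)))).mul (hp _ _)
  · have hw : ∀ j, tWeight η c m n j ≠ 0 := fun j => Complex.exp_ne_zero _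
    refine ⟨⟨twist 1 (tWeight η c m n), twist 1 (tWeight η c m n)⁻¹, ?_, ?_⟩, rfl⟩
    · rw [twist_mul_twist, one_mul, ← twist_one_one]
      congr 1
      exact funext fun j => mul_inv_cancel₀ (hw j)
    · rw [twist_mul_twist, one_mul, ← twist_one_one]
      congr 1
      exact funext fun j => inv_mul_cancel₀ (hw j)

theorem scal_mul (X Y : Op) : scal X * scal Y = scal (X * Y) := Matrix.diagonal_mul_diagonal _ _

theorem scal_one : scal 1 = 1 := Matrix.diagonal_one

theorem isUnit_scal {X : Op} (h : IsUnit X) : IsUnit (scal X) := by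
  obtain ⟨u, rfl⟩ := h
  exact ⟨⟨scal u, scal ↑u⁻¹, by rw [scal_mul, Units.mul_inv, scal_one],
    by rw [scal_mul, Units.inv_mul, scal_one]⟩, rfl⟩

theorem qpow_add (η a b : ℂ) : qpow η (a + b) = qpow η a * qpow η b := by
  ext
  rw [Units.val_mul, coe_qpow, coe_qpow, coe_qpow, add_mul, Complex.exp_add]

theorem qpow_zero (η : ℂ) : qpow η 0 = 1 := by
  ext
  rw [coe_qpow, zero_mul, Complex.exp_zero, Units.val_one]

theorem qpow_neg (η a : ℂ) : qpow η (-a) = (qpow η a)⁻¹ :=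
  eq_inv_of_mul_eq_one_left (by rw [← qpow_add, neg_add_cancel, qpow_zero])

/-- The exponent of the dilation in the factor of a lattice point. -/
def laxExponent (c : ZMod 2 → Sgn → ℂ) : ZMod 2 × Sgn → ℂ
  | (m, .plus) => -c m .plus
  | (m, .minus) => c m .minus

theorem shiftUnit_localLax {η : ℂ} (hη : η.re < 0) (c : ZMod 2 → Sgn → ℂ) (s : ℂˣ) :
    ∀ p, ShiftUnit (qpow η (laxExponent c p)) (localLax η c s p)
  | (m, .plus) => shiftUnit_Lplus hη c s m
  | (m, .minus) => by
    have h := (shiftUnit_Lminus hη c s m).inverse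
    rwa [qpow_neg, inv_inv] at h

theorem shiftUnit_lax {η : ℂ} (hη : η.re < 0) (c : ZMod 2 → Sgn → ℂ) (s : ℂˣ)
    (w : List (ZMod 2 × Sgn)) :
    ShiftUnit (qpow η (w.map (laxExponent c)).sum) (lax η c s w) := by
  induction w with
  | nil =>
    simp only [lax, List.map_nil, List.sum_nil, List.prod_nil, qpow_zero]
    exact shiftUnit_one
  | cons p w ih =>
    simp only [lax, List.map_cons, List.sum_cons, List.prod_cons, qpow_add]
    exact (shiftUnit_localLax hη c s p).mul ih

theorem isPointwise_laxRed {η : ℂ} (hη : η.re < 0) (c : ZMod 2 → Sgn → ℂ) (s : ℂˣ)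
    {w : List (ZMod 2 × Sgn)} (hw : (w.map (laxExponent c)).sum = cTot c) (i j : Fin 2) :
    IsPointwise (laxRed η c s w i j) := by
  have hd : ShiftUnit (qpow η (-cTot c)) (scal (dil (qpow η (-cTot c)))) := by
    rw [dil_eq]
    exact shiftUnit_diagonal_twist _ (fun _ => 1) fun _ _ => one_ne_zero
  obtain ⟨-, -, -, h, -⟩ := hd.mul (shiftUnit_lax hη c s w)
  rw [hw, ← qpow_add, neg_add_cancel, qpow_zero] at h
  obtain ⟨F, hF⟩ := h i j
  exact ⟨F, fun φ z => by rw [laxRed, hF, one_mul]⟩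

/-! ### Dilations of the spectral parameter -/

/-- Apart from its own dilation, which commutes with `dil a`, the matrix depends on `z` only through
`s z`. -/
theorem scal_dil_mul_Lminus {η : ℂ} (c : ZMod 2 → Sgn → ℂ) (s a : ℂˣ)
    (m : ZMod 2) : scal (dil a) * Lminus η c s m = Lminus η c (s * a) m * scal (dil a) := by
  have hF : ∀ F : Wave, dil a * mulHom F = mulHom (fun z => F (a * z)) * dil a := fun F => rfl
  have h1 : (fun z => laxFactor η (specMinus s) m .minus (a * z)) =
      laxFactor η (specMinus (s * a)) m .minus := by
    funext z
    simp [laxFactor, qPochW, genDel, gen, specMinus, mul_assoc]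
  have h2 : ∀ i j, (fun z => matMinus η s m i j (a * z)) = matMinus η (s * a) m i j := by
    intro i j
    funext z
    fin_cases i <;> fin_cases j <;> simp [matMinus, gen, specMinus, mul_assoc]
  rw [Lminus_eq, Lminus_eq, scal]
  ext1 i j
  rw [Matrix.diagonal_mul, Matrix.mul_diagonal, Matrix.of_apply, Matrix.of_apply, ← mul_assoc, hF,
    ← h1, ← h2, mul_assoc, mul_assoc, dil_eq, (commute_twist _ _ _ _).eq]
  rfl

theorem commute_dil_R (η : ℂ) (c : ZMod 2 → Sgn → ℂ) (a : ℂˣ) (m n : ZMod 2) :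
    Commute (dil a) (R η c m n) := by
  rw [R]
  rfl

theorem scal_dil_mul_B {η : ℂ} (c : ZMod 2 → Sgn → ℂ) (s a : ℂˣ) :
    scal (dil a) * B η c s = B η c (s * a) * scal (dil a) := by
  have h0 : Commute (dil a) (H0 η c) :=
    (commute_dil_R η c a 1 1).mul_right (commute_dil_R η c a 2 2)
  have h1 : Commute (dil a) (H1 η c) :=
    (commute_dil_R η c a 2 1).mul_right (commute_dil_R η c a 3 2)
  rw [B, B, ← mul_assoc, ← mul_assoc, scal_mul, h0.eq, ← scal_mul, mul_assoc (scal (H0 η c)),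
    scal_dil_mul_Lminus, mul_assoc, mul_assoc, scal_mul, h1.eq, ← scal_mul]
  simp only [mul_assoc]

/-! ### The Schlesinger equation -/

/-- The algebra behind the Schlesinger equation: `pᵢ` and `mᵢ` stand for the Lax matrices at `i⁺`
and `i⁻`, and `rᵢⱼ` for the R matrix at `i⁺` and `j⁻`. -/
theorem schlesinger_of_exchange {A : Type*} [Monoid A] {p₁ p₂ r₁₁ r₂₂ r₂₁ r₁₂ : A} (m₁ m₂ : Aˣ)
    (e₁₁ : p₁ * r₁₁ * m₁ = m₁ * r₁₁ * p₁) (e₂₂ : p₂ * r₂₂ * m₂ = m₂ * r₂₂ * p₂)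
    (e₂₁ : p₂ * r₂₁ * m₁ = m₁ * r₂₁ * p₂) (e₁₂ : p₁ * r₁₂ * m₂ = m₂ * r₁₂ * p₁)
    (a₁ : Commute r₁₁ m₂) (a₂ : Commute p₂ r₁₁) (a₃ : Commute p₁ r₂₂) (a₄ : Commute r₂₂ m₁)
    (a₅ : Commute p₁ r₂₁) (a₆ : Commute r₂₁ m₂) (a₇ : Commute p₂ r₁₂) (a₈ : Commute r₁₂ m₁) :
    ↑m₁⁻¹ * p₁ * ↑m₂⁻¹ * p₂ * (r₁₁ * r₂₂ * m₂ * (r₂₁ * r₁₂)) =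
      r₁₁ * r₂₂ * m₂ * (r₂₁ * r₁₂) * (p₁ * ↑m₂⁻¹ * p₂ * ↑m₁⁻¹) := by
  -- The exchange relation rewritten for `m⁻¹`. It is needed for `m₁` only: `m₂⁻¹` is cancelled by
  -- means of `e₂₂` and recreated by means of `e₁₂`.
  have key : ∀ {p r : A} (m : Aˣ), p * r * m = m * r * p → ↑m⁻¹ * p * r = r * p * ↑m⁻¹ := by
    intro p r m h
    rw [Units.eq_mul_inv_iff_mul_eq, mul_assoc, mul_assoc, Units.inv_mul_eq_iff_eq_mul,
      ← mul_assoc, ← mul_assoc, h]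
  have f₁₁ := key m₁ e₁₁
  have f₂₁ := key m₁ e₂₁
  have a₁' : Commute r₁₁ ↑m₂⁻¹ := a₁.units_inv_right
  have a₄' : Commute r₂₂ ↑m₁⁻¹ := a₄.units_inv_right
  have a₈' : Commute r₁₂ ↑m₁⁻¹ := a₈.units_inv_right
  calc ↑m₁⁻¹ * p₁ * ↑m₂⁻¹ * p₂ * (r₁₁ * r₂₂ * m₂ * (r₂₁ * r₁₂))
      = ↑m₁⁻¹ * p₁ * ↑m₂⁻¹ * (p₂ * r₁₁) * r₂₂ * m₂ * (r₂₁ * r₁₂) := by simp only [mul_assoc]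
    _ = ↑m₁⁻¹ * p₁ * (r₁₁ * ↑m₂⁻¹) * (p₂ * r₂₂ * m₂) * (r₂₁ * r₁₂) := by
      rw [a₂.eq, a₁'.eq]; simp only [mul_assoc]
    _ = ↑m₁⁻¹ * p₁ * r₁₁ * (↑m₂⁻¹ * m₂) * r₂₂ * p₂ * (r₂₁ * r₁₂) := by
      rw [e₂₂]; simp only [mul_assoc]
    _ = r₁₁ * p₁ * (r₂₂ * ↑m₁⁻¹) * p₂ * r₂₁ * r₁₂ := by
      rw [f₁₁, a₄'.eq, Units.inv_mul]; simp only [mul_assoc, mul_one]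
    _ = r₁₁ * (p₁ * r₂₂) * (↑m₁⁻¹ * p₂ * r₂₁) * r₁₂ := by simp only [mul_assoc]
    _ = r₁₁ * r₂₂ * (p₁ * r₂₁) * p₂ * (↑m₁⁻¹ * r₁₂) := by
      rw [f₂₁, a₃.eq]; simp only [mul_assoc]
    _ = r₁₁ * r₂₂ * r₂₁ * p₁ * (p₂ * r₁₂) * ↑m₁⁻¹ := by
      rw [← a₈'.eq, a₅.eq]; simp only [mul_assoc]
    -- `m₂ * m₂⁻¹` is inserted so that `e₁₂` applies and leaves `m₂⁻¹` between `p₁` and `p₂`.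
    _ = r₁₁ * r₂₂ * r₂₁ * (p₁ * r₁₂ * m₂ * ↑m₂⁻¹) * p₂ * ↑m₁⁻¹ := by
      rw [a₇.eq, Units.mul_inv_cancel_right]; simp only [mul_assoc]
    _ = r₁₁ * r₂₂ * (r₂₁ * m₂) * r₁₂ * p₁ * ↑m₂⁻¹ * p₂ * ↑m₁⁻¹ := by
      rw [e₁₂]; simp only [mul_assoc]
    _ = _ := by rw [a₆.eq]; simp only [mul_assoc]

theorem lax_word_mul_B {η : ℂ} (hη : η.re < 0) (c : ZMod 2 → Sgn → ℂ) (s : ℂˣ) :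
    lax η c s word * B η c s = B η c s * lax η c s word' := by
  obtain ⟨m₁, hm₁⟩ := (shiftUnit_Lminus hη c s 1).isUnit
  obtain ⟨m₂, hm₂⟩ := (shiftUnit_Lminus hη c s 2).isUnit
  have h12 : (1 : ZMod 2) ≠ 2 := by decide
  have h3 : (3 : ZMod 2) = 1 := by decide
  have h := schlesinger_of_exchange (p₁ := Lplus η c s 1) (p₂ := Lplus η c s 2)
    (r₁₁ := scal (R η c 1 1)) (r₂₂ := scal (R η c 2 2)) (r₂₁ := scal (R η c 2 1))
    (r₁₂ := scal (R η c 1 2)) m₁ m₂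
    (by rw [hm₁]; exact Lplus_R_Lminus hη c s 1 1) (by rw [hm₂]; exact Lplus_R_Lminus hη c s 2 2)
    (by rw [hm₁]; exact Lplus_R_Lminus hη c s 2 1) (by rw [hm₂]; exact Lplus_R_Lminus hη c s 1 2)
    (by rw [hm₂]; exact (commute_Lminus_R hη c s h12.symm 1).symm)
    (commute_Lplus_R hη c s h12.symm 1) (commute_Lplus_R hη c s h12 2)
    (by rw [hm₁]; exact (commute_Lminus_R hη c s h12 2).symm)
    (commute_Lplus_R hη c s h12 1)
    (by rw [hm₂]; exact (commute_Lminus_R hη c s h12.symm 2).symm)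
    (commute_Lplus_R hη c s h12.symm 2)
    (by rw [hm₁]; exact (commute_Lminus_R hη c s h12 1).symm)
  rw [← Ring.inverse_unit m₁, ← Ring.inverse_unit m₂, hm₁, hm₂] at h
  simp only [lax, word, word', localLax, List.map_cons, List.map_nil, List.prod_cons,
    List.prod_nil, mul_one, B, H0, H1, h3, ← scal_mul]
  simp only [mul_assoc] at h ⊢
  exact h

/-- Carrying `q^(-D)` across `B` is what shifts the spectral parameter of `B` by `q^(-c)`. -/
theorem laxRed_mul_B {η : ℂ} (hη : η.re < 0) (c : ZMod 2 → Sgn → ℂ) (s : ℂˣ) :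
    laxRed η c s word * B η c s = B η c (s * qpow η (-cTot c)) * laxRed η c s word' := by
  rw [laxRed, laxRed, mul_assoc, lax_word_mul_B hη, ← mul_assoc, scal_dil_mul_B, mul_assoc]

theorem isUnit_H0 {η : ℂ} (hη : η.re < 0) (c : ZMod 2 → Sgn → ℂ) : IsUnit (H0 η c) :=
  (isUnit_R hη c 1 1).mul (isUnit_R hη c 2 2)

theorem isUnit_H1 {η : ℂ} (hη : η.re < 0) (c : ZMod 2 → Sgn → ℂ) : IsUnit (H1 η c) :=
  (isUnit_R hη c 2 1).mul (isUnit_R hη c 3 2)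

theorem isUnit_gauge {η : ℂ} (hη : η.re < 0) (c : ZMod 2 → Sgn → ℂ) (s : ℂˣ) :
    IsUnit (gauge η c s) :=
  ((isUnit_scal (isUnit_H1 hη c).ringInverse).mul (shiftUnit_Lminus hη c s 2).isUnit).mul
    (isUnit_scal (isUnit_H1 hη c))

theorem scal_H_mul_gauge {η : ℂ} (hη : η.re < 0) (c : ZMod 2 → Sgn → ℂ) (s : ℂˣ) :
    scal (H0 η c * H1 η c) * gauge η c s = B η c s := by
  rw [gauge, B, ← mul_assoc, ← mul_assoc, scal_mul, mul_assoc (H0 η c),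
    Ring.mul_inverse_cancel _ (isUnit_H1 hη c), mul_one]

theorem map_evol (η : ℂ) (c : ZMod 2 → Sgn → ℂ) (M : OpMat) :
    M.map (evol η c) =
      scal (Ring.inverse (H0 η c * H1 η c)) * M * scal (H0 η c * H1 η c) := by
  ext1 i j
  rw [scal, scal, Matrix.mul_diagonal, Matrix.diagonal_mul, Matrix.map_apply, evol]

/-- Since `B = H_0 H_1 G` at both spectral parameters, cancelling `H_0 H_1` on the left of the
reduced equation gives the gauge relation. -/
theorem evol_laxRed_mul_gauge {η : ℂ} (hη : η.re < 0) (c : ZMod 2 → Sgn → ℂ) (s : ℂˣ) :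
    (laxRed η c s word).map (evol η c) * gauge η c s =
      gauge η c (s * qpow η (-cTot c)) * laxRed η c s word' := by
  rw [map_evol, mul_assoc, scal_H_mul_gauge hη, mul_assoc, laxRed_mul_B hη,
    ← scal_H_mul_gauge hη, ← mul_assoc, ← mul_assoc, scal_mul,
    Ring.inverse_mul_cancel _ ((isUnit_H0 hη c).mul (isUnit_H1 hη c)), scal_one, one_mul]

end QPVI

end

theorem theorem3 (η : ℂ) (hη : η.re < 0) (c : ZMod 2 → QPVI.Sgn → ℂ) (s : ℂˣ) :
    -- all inverses that occur are inverses of invertible operators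
    ((∀ m n : ZMod 2, IsUnit (QPVI.R η c m n)) ∧
      (∀ m : ZMod 2, IsUnit (QPVI.Lminus η c s m)) ∧
      IsUnit (QPVI.gauge η c s)) ∧
    -- the quantized discrete Schlesinger equation
    QPVI.lax η c s QPVI.word * QPVI.B η c s = QPVI.B η c s * QPVI.lax η c s QPVI.word' ∧
    -- the same equation without the difference operator part `q ^ D`
    (∀ i j, QPVI.IsPointwise (QPVI.laxRed η c s QPVI.word i j)) ∧
    (∀ i j, QPVI.IsPointwise (QPVI.laxRed η c s QPVI.word' i j)) ∧
    QPVI.laxRed η c s QPVI.word * QPVI.B η c s =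
      QPVI.B η c (s * QPVI.qpow η (-QPVI.cTot c)) * QPVI.laxRed η c s QPVI.word' ∧
    -- the matrix on the right is the evolved Lax matrix, in another gauge
    (QPVI.laxRed η c s QPVI.word).map (QPVI.evol η c) * QPVI.gauge η c s =
      QPVI.gauge η c (s * QPVI.qpow η (-QPVI.cTot c)) * QPVI.laxRed η c s QPVI.word' := by
  refine ⟨⟨QPVI.isUnit_R hη c, fun m => (QPVI.shiftUnit_Lminus hη c s m).isUnit,
    QPVI.isUnit_gauge hη c s⟩, QPVI.lax_word_mul_B hη c s,
    QPVI.isPointwise_laxRed hη c s ?_, QPVI.isPointwise_laxRed hη c s ?_,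
    QPVI.laxRed_mul_B hη c s, QPVI.evol_laxRed_mul_gauge hη c s⟩
  -- The two words are cyclic permutations of each other, so both have total dilation exponent `c`.
  all_goals
    simp only [QPVI.word, QPVI.word', QPVI.laxExponent, QPVI.cTot, List.map_cons, List.map_nil,
      List.sum_cons, List.sum_nil]
    ring
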